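/- \textbf{Setting.} Let $\phi:[0,\infty)\times[0,\infty)\to[0,\infty)$ be a flow: $\phi$ is $\mathcal C^1$, $\phi(x,0)=x$, $\phi(x,t+s)=\phi(\phi(x,s),t)$, every $\phi(\cdot,t)$ is a homeomorphism onto its image, and every $\phi_x=\phi(x,\cdot)$ is an increasing $\mathcal C^1$-diffeomorphism of $[0,\infty)$ onto $[x,\infty)$. Let $f:[0,\infty)\to[0,\infty)$ be an increasing $\mathcal C^1$-diffeomorphism such that, for some $0<\kappa<1$, $0<f(x)\le\kappa x$ for all $x>0$. Put $g_x(y)=[(f\circ\phi_x)^{-1}]'(y)$ for $y\ge f(x)$ and suppose that there are continuous functions $\mathbf m,\mathbf M:[0,\infty)\to(0,\infty)$ with $\mathbf m\le\mathbf M$ and $\mathbf m(y)\le g_x(y)\le\mathbf M(y)$ for all $x\ge0$ and all $y>0$ with $y\ge f(x)$. For $b>0$ and $\mathfrak c=(r,L,\mathbf a)$ with $r,L,\mathbf a>0$ and \[ r\ge f^{-1}\left(\left[\frac{-\ln(1-\kappa^{b+1})}{1-\kappa^{b+1}}\right]^{1/(b+1)}\right), \] let $\mathcal F(\mathfrak c,b)$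 be the set of continuous functions $\lambda:[0,\infty)\to[0,\infty)$ such that \[ \frac{f(x)^b}{\mathbf m(f(x))}\le\frac{\lambda(x)}{\mathbf a}\quad(x\ge r),\qquad \int_0^{f(r)}\mathbf M(u)\,\lambda(f^{-1}(u))\,du\le L. \] For a jump rate $\lambda\in\mathcal F(\mathfrak c,b)$ and $x\ge0$ let $T_1$ be a random time with $\mathbb P_x(T_1>t)=\exp\left(-\int_0^t\lambda(\phi(x,s))\,ds\right)$, and let $\mathcal P_\lambda(x,\cdot)$ be the law of $f(\phi(x,T_1))$. Let $(Z_k)_{k\ge0}$ be the Markov chain with $Z_0=x_0$ and transition kernel $\mathcal P_\lambda$, that is, the chain of post-jump locations of the piecewise deterministic Markov process with flow $\phi$, jump rate $\lambda$ and deterministic jumps $x\mapsto f(x)$, started at $x_0$. Put $\mathbb V(x)=\exp\left(\frac{\mathbf a}{b+1}f(x)^{b+1}\right)$ and, for bounded $s$, $\|s\|_\infty=\sup_{x\ge0}|s(x)|$. \textbf{Statement.} With $\phi,f,\kappa,\mathbf m,\mathbf M,\mathfrak c,b$ as above, there are constants $R>0$ and $\gamma\in(0,1)$ such that the following holds. (i)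 For every $\lambda\in\mathcal F(\mathfrak c,b)$ the kernel $\mathcal P_\lambda$ has exactly one invariant probability measure; it has a density $\nu_\lambda$ with respect to Lebesgue measure on $[0,\infty)$; $\int\mathbb V\nu_\lambda<\infty$; and for all $k\ge0$ and $x\ge0$, $\mathcal P_\lambda^k\mathbb V(x)<\infty$ and \[ \left|\mathcal P_\lambda^k\psi(x)-\int\psi(z)\nu_\lambda(z)\,dz\right|\le R\,\mathbb V(x)\,\gamma^k\qquad\text{for all measurable }\psi\text{ with }|\psi|\le\mathbb V. \] (ii) The functions $G_\lambda(z)=\frac{R}{1-\gamma}\left(\mathbb V(z)+\int\mathbb V(x)\nu_\lambda(x)\,dx\right)$ satisfy $\sup_{\lambda\in\mathcal F(\mathfrak c,b)}G_\lambda(z)<\infty$ for every $z\ge0$. (iii) For every $x_0\ge0$ there is a constant $c$, which depends neither on $\lambda$, nor on $s$, nor on $n$, such that for every $\lambda\in\mathcal F(\mathfrak c,b)$, every bounded measurable $s:[0,\infty)\to\mathbb R$ and every $n\ge1$, \[ \left|\mathbb E\left[\frac1n\sum_{k=1}^n s(Z_k)-\int s(x)\nu_\lambda(x)\,dx\right]\right|\le\|s\|_\infty\frac{R\,\mathbb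 V(x_0)}{n(1-\gamma)} \] and \[ \operatorname{Var}\left(\frac1n\sum_{k=1}^n s(Z_k)\right)\le\frac1n\int s^2(z)\nu_\lambda(z)\,dz+\frac{\|s\|_\infty}{n}\int|s(z)|\,\nu_\lambda(z)\,G_\lambda(z)\,dz+\frac{c\,\|s\|_\infty^2}{n^2}. \] -/

import Mathlib

open MeasureTheory ProbabilityTheory Set
open scoped NNReal ENNReal

namespace PDMP

/-- Lebesgue measure on the half-line `[0, ∞)`. -/
noncomputable def halfLine : Measure ℝ≥0 :=
  ((volume : Measure ℝ).restrict (Ici 0)).map Real.toNNReal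

instance : SFinite halfLine := by
  unfold halfLine
  infer_instance

/-- The flow `φ x t`, started at `x`, after time `t`: it is jointly `C¹` on `[0, ∞) × [0, ∞)`,
each `φ(·, t)` is a homeomorphism onto its image, the semigroup property holds, and each
`φ(x, ·)` is an increasing `C¹`-diffeomorphism of `[0, ∞)` onto `[x, ∞)`. -/
structure IsFlow (φ : ℝ≥0 → ℝ≥0 → ℝ≥0) : Prop where
  contDiff : ContDiffOn ℝ 1
    (fun p : ℝ × ℝ => (φ p.1.toNNReal p.2.toNNReal : ℝ)) (Ici 0 ×ˢ Ici 0)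
  embedding : ∀ t, Topology.IsEmbedding fun x => φ x t
  zero : ∀ x, φ x 0 = x
  semigroup : ∀ x s t, φ x (t + s) = φ (φ x s) t
  strictMono : ∀ x, StrictMono (φ x)
  range_eq : ∀ x, range (φ x) = Ici x
  deriv_pos : ∀ x t : ℝ≥0,
    0 < derivWithin (fun u : ℝ => (φ x u.toNNReal : ℝ)) (Ici 0) t

/-- The increasing bijection `f` of `[0, ∞)` is a `C¹`-diffeomorphism. -/
structure IsC1Diffeo (f : ℝ≥0 ≃o ℝ≥0) : Prop where
  contDiff : ContDiffOn ℝ 1 (fun x : ℝ => (f x.toNNReal : ℝ)) (Ici 0)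
  contDiff_symm : ContDiffOn ℝ 1 (fun x : ℝ => (f.symm x.toNNReal : ℝ)) (Ici 0)

/-- `g_x(y)`, the derivative at `y` of the inverse of `t ↦ f (φ x t)`, for `y ≥ f x`. -/
noncomputable def invDeriv (φ : ℝ≥0 → ℝ≥0 → ℝ≥0) (f : ℝ≥0 ≃o ℝ≥0) (x y : ℝ≥0) : ℝ :=
  derivWithin (fun u : ℝ => ((Function.invFun (fun t : ℝ≥0 => f (φ x t)) u.toNNReal : ℝ≥0) : ℝ))
    (Ici (f x : ℝ)) y

/-- The standing assumptions on the flow `φ` and the jump map `f`, with the contraction factor `κ`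
and the bounds `m ≤ g ≤ M`. -/
structure Assumptions (φ : ℝ≥0 → ℝ≥0 → ℝ≥0) (f : ℝ≥0 ≃o ℝ≥0) (κ : ℝ) (m M : ℝ≥0 → ℝ) :
    Prop where
  isFlow : IsFlow φ
  isC1Diffeo : IsC1Diffeo f
  kappa_pos : 0 < κ
  kappa_lt_one : κ < 1
  map_le : ∀ x, 0 < x → 0 < f x ∧ (f x : ℝ) ≤ κ * x
  continuous_m : Continuous m
  continuous_M : Continuous M
  m_pos : ∀ y, 0 < m y
  m_le_M : ∀ y, m y ≤ M y
  invDeriv_mem : ∀ x y, 0 < y → f x ≤ y → m y ≤ invDeriv φ f x y ∧ invDeriv φ f x y ≤ M y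

/-- Admissible parameters `(r, L, a)` and `b` of a class of jump rates. -/
structure Parameters (f : ℝ≥0 ≃o ℝ≥0) (κ : ℝ) (r : ℝ≥0) (L a b : ℝ) : Prop where
  r_pos : 0 < r
  L_pos : 0 < L
  a_pos : 0 < a
  b_pos : 0 < b
  le_r : f.symm (Real.toNNReal
    ((-Real.log (1 - κ ^ (b + 1)) / (1 - κ ^ (b + 1))) ^ (1 / (b + 1)))) ≤ r

/-- The class `ℱ(𝔠, b)`, `𝔠 = (r, L, a)`, of jump rates. -/
def rateClass (f : ℝ≥0 ≃o ℝ≥0) (m M : ℝ≥0 → ℝ) (r : ℝ≥0) (L a b : ℝ) : Set (ℝ≥0 → ℝ≥0) :=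
  {rate | Continuous rate ∧
    (∀ x, r ≤ x → (f x : ℝ) ^ b / m (f x) ≤ rate x / a) ∧
    ∫ u in (0 : ℝ)..(f r), M u.toNNReal * rate (f.symm u.toNNReal) ≤ L}

/-- The cumulated jump rate `Λ(x, t) = ∫₀ᵗ λ(φ(x, s)) ds`. -/
noncomputable def cumRate (φ : ℝ≥0 → ℝ≥0 → ℝ≥0) (rate : ℝ≥0 → ℝ≥0) (x t : ℝ≥0) : ℝ :=
  ∫ s in (0 : ℝ)..t, (rate (φ x s.toNNReal) : ℝ)

/-- The density at `t` of the first jump time `T₁` from `x`, whose survival function is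
`exp (-Λ(x, t))`. -/
noncomputable def jumpTimeDensity (φ : ℝ≥0 → ℝ≥0 → ℝ≥0) (rate : ℝ≥0 → ℝ≥0) (x t : ℝ≥0) : ℝ≥0 :=
  rate (φ x t) * Real.toNNReal (Real.exp (-cumRate φ rate x t))

/-- The law of the first jump time `T₁` of the process started at `x`. -/
noncomputable def jumpTimeKernel (φ : ℝ≥0 → ℝ≥0 → ℝ≥0) (rate : ℝ≥0 → ℝ≥0) : Kernel ℝ≥0 ℝ≥0 :=
  Kernel.withDensity (Kernel.const ℝ≥0 halfLine) fun x t => (jumpTimeDensity φ rate x t : ℝ≥0∞)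

instance (φ : ℝ≥0 → ℝ≥0 → ℝ≥0) (rate : ℝ≥0 → ℝ≥0) : IsSFiniteKernel (jumpTimeKernel φ rate) := by
  unfold jumpTimeKernel
  infer_instance

/-- The transition kernel `𝒫_λ(x, dy)` of the post-jump chain: the law of `Z₁ = f (φ x T₁)`. -/
noncomputable def jumpKernel (φ : ℝ≥0 → ℝ≥0 → ℝ≥0) (f : ℝ≥0 ≃o ℝ≥0) (rate : ℝ≥0 → ℝ≥0) :
    Kernel ℝ≥0 ℝ≥0 :=
  (Kernel.id ×ₖ jumpTimeKernel φ rate).map fun p => f (φ p.1 p.2)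

/-- For a continuous flow and a continuous rate, `jumpKernel` is the image under `t ↦ f (φ x t)`
of the measure with density `jumpTimeDensity`. -/
theorem jumpKernel_apply {φ : ℝ≥0 → ℝ≥0 → ℝ≥0} (f : ℝ≥0 ≃o ℝ≥0) {rate : ℝ≥0 → ℝ≥0}
    (hφ : Continuous (Function.uncurry φ)) (hrate : Continuous rate) (x : ℝ≥0) :
    jumpKernel φ f rate x =
      (halfLine.withDensity fun t => (jumpTimeDensity φ rate x t : ℝ≥0∞)).map
        fun t => f (φ x t) := by
  have hcum : Continuous fun p : ℝ≥0 × ℝ≥0 => cumRate φ rate p.1 p.2 := by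
    unfold cumRate
    refine intervalIntegral.continuous_parametric_intervalIntegral_of_continuous
      (f := fun (p : ℝ≥0 × ℝ≥0) (s : ℝ) => (rate (φ p.1 s.toNNReal) : ℝ))
      (s := fun p : ℝ≥0 × ℝ≥0 => (p.2 : ℝ)) ?_ (by fun_prop)
    have h : Continuous fun q : (ℝ≥0 × ℝ≥0) × ℝ => Function.uncurry φ (q.1.1, q.2.toNNReal) :=
      hφ.comp (by fun_prop)
    exact NNReal.continuous_coe.comp (hrate.comp h)
  have hdens : Measurable
      (Function.uncurry fun x t : ℝ≥0 => (jumpTimeDensity φ rate x t : ℝ≥0∞)) := by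
    have h : Continuous fun p : ℝ≥0 × ℝ≥0 => jumpTimeDensity φ rate p.1 p.2 := by
      unfold jumpTimeDensity
      exact (hrate.comp hφ).mul (by fun_prop)
    exact (ENNReal.continuous_coe.comp h).measurable
  have hmap : Measurable fun p : ℝ≥0 × ℝ≥0 => f (φ p.1 p.2) :=
    (f.continuous.comp hφ).measurable
  rw [jumpKernel, Kernel.map_apply _ hmap, Kernel.prod_apply, jumpTimeKernel,
    Kernel.withDensity_apply _ hdens, Kernel.id_apply, Kernel.const_apply, Measure.dirac_prod,
    Measure.map_map hmap (by fun_prop)]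
  rfl

/-- `Z` is, under `P`, the sequence of post-jump locations of the process started at `x₀`:
`Z₀ = x₀`, and given `Z₀, …, Z_k` the next location `Z_{k+1}` has law `𝒫_λ(Z_k, ·)`. -/
structure IsJumpChain {Ω : Type*} [MeasurableSpace Ω] (P : Measure Ω) (φ : ℝ≥0 → ℝ≥0 → ℝ≥0)
    (f : ℝ≥0 ≃o ℝ≥0) (rate : ℝ≥0 → ℝ≥0) (x₀ : ℝ≥0) (Z : ℕ → Ω → ℝ≥0) : Prop where
  measurable : ∀ k, Measurable (Z k)
  init : ∀ᵐ ω ∂P, Z 0 ω = x₀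
  transition : ∀ k, HasCondDistrib (Z (k + 1)) (fun ω (i : Finset.Iic k) => Z i ω)
    ((jumpKernel φ f rate).comap (fun h : Finset.Iic k → ℝ≥0 => h ⟨k, by simp⟩)
      (measurable_pi_apply _)) P

/-- The probability measure on `[0, ∞)` with density `p`. -/
noncomputable def densityMeasure (p : ℝ≥0 → ℝ≥0) : Measure ℝ≥0 :=
  halfLine.withDensity fun x => (p x : ℝ≥0∞)

/-- `p` is the density of the unique invariant probability measure of the kernel `K`. -/
structure IsUniqueInvariantDensity (K : Kernel ℝ≥0 ℝ≥0) (p : ℝ≥0 → ℝ≥0) : Prop where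
  measurable : Measurable p
  isProbabilityMeasure : IsProbabilityMeasure (densityMeasure p)
  invariant : K.Invariant (densityMeasure p)
  unique : ∀ π : Measure ℝ≥0, IsProbabilityMeasure π → K.Invariant π → π = densityMeasure p

/-- The function `𝕍(x) = exp (a / (b + 1) * f(x) ^ (b + 1))`. -/
noncomputable def V (f : ℝ≥0 ≃o ℝ≥0) (a b : ℝ) (x : ℝ≥0) : ℝ :=
  Real.exp (a / (b + 1) * (f x : ℝ) ^ (b + 1))

/-- The function `G_λ(z) = R / (1 - γ) * (𝕍(z) + ∫ 𝕍(x) ν_λ(x) dx)`, where `p = ν_λ`. -/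
noncomputable def G (f : ℝ≥0 ≃o ℝ≥0) (a b R γ : ℝ) (p : ℝ≥0 → ℝ≥0) (z : ℝ≥0) : ℝ :=
  R / (1 - γ) * (V f a b z + ∫ x, V f a b x * p x ∂halfLine)

/-- The sup norm of a (bounded) function. -/
noncomputable def supNorm (s : ℝ≥0 → ℝ) : ℝ := ⨆ x, |s x|

end PDMP

/-! The proof is Harris' theorem with every constant uniform over the class of jump rates. It needs
a geometric drift condition for `V` and a minorization on a sublevel set of `V`, both with constants
that do not depend on `rate`.

Both come from reading the cumulated hazard Λ in the coordinate u = f(φ(x,t)), the post-jump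
location. There its derivative is λ(f⁻¹(u)) g_x(u), which lies between λ(f⁻¹(u)) m(u) and λ(f⁻¹(u))
M(u), bounds free of x. Beyond f(r) the class forces growth at least a u^b, so Λ dominates a/(b+1) ·
u^(b+1) up to a constant (`rpow_sub_le_hazardAt`); below f(r) it is at most L (`hazardAt_le`).

Drift: Λ at the jump time is a standard exponential variable, and the contraction f(z) ≤ κz
multiplies the exponent in `V` by at most θ = κ^(b+1) < 1. Hence the mean of `V` after one jump is
at most a constant times V^θ, which is sublinear in `V` (`lintegral_V_le`, `exists_drift`).

Minorization: with probability bounded below a jump shrinks max(x, r) by a fixed factor, so a fixed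
number of jumps leads from a sublevel set of `V` into [0, r] (`exists_descent`). From there the law
of the next location has a component of mass bounded below, common to all starting points
(`exists_minorization`). This component depends on λ; only its mass is uniform, and that is enough.

The Hairer–Mattingly argument turns drift and minorization into a contraction of weighted
oscillations (`exists_weighted_contraction`, `exists_geometric_oscillation`). The laws of the chain
then have Cauchy densities in L¹, whose limit is the invariant density (`exists_invariant_density`).
Geometric ergodicity in the `V`-weighted norm, together with the Markov property, gives the bias by
summing a geometric series and the variance by bounding covariances (`covariance_le`). -/

namespace PDMP

/-! ### Harris' theorem: drift and minorization give geometric decay of oscillations. -/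

section Harris

open Filter Topology

variable {X : Type*} [MeasurableSpace X] {V : X → ℝ}

/-- The geometric drift condition `P V ≤ η V + C`. -/
def Drift (P : Kernel X X) (V : X → ℝ) (η C : ℝ) : Prop :=
  ∀ x, Integrable V (P x) ∧ ∫ z, V z ∂(P x) ≤ η * V x + C

instance isMarkovKernel_pow (P : Kernel X X) [IsMarkovKernel P] (n : ℕ) :
    IsMarkovKernel (P ^ n) := by
  induction n with
  | zero => rw [pow_zero]; exact inferInstanceAs (IsMarkovKernel Kernel.id)
  | succ n ih => rw [pow_succ]; exact inferInstanceAs (IsMarkovKernel ((P ^ n) ∘ₖ P))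

theorem pow_zero_kernel_apply (P : Kernel X X) (x : X) : (P ^ 0) x = Measure.dirac x := by
  rw [pow_zero]; exact Kernel.id_apply x

theorem integrable_of_abs_le {μ : Measure X} {W ψ : X → ℝ} (hW : Integrable W μ)
    (hψ : Measurable ψ) (h : ∀ z, |ψ z| ≤ W z) : Integrable ψ μ :=
  hW.mono' hψ.aestronglyMeasurable (ae_of_all _ h)

theorem integral_pow_add (P : Kernel X X) (m n : ℕ) {ψ : X → ℝ} {x : X}
    (h : Integrable ψ ((P ^ (m + n)) x)) :
    ∫ z, ψ z ∂((P ^ (m + n)) x) = ∫ y, ∫ z, ψ z ∂((P ^ m) y) ∂((P ^ n) x) := by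
  rw [Kernel.pow_add] at h ⊢
  exact Kernel.integral_comp h

theorem measurable_integral_kernel (P : Kernel X X) [IsMarkovKernel P] {ψ : X → ℝ}
    (hψ : Measurable ψ) : Measurable fun x => ∫ z, ψ z ∂(P x) :=
  (StronglyMeasurable.integral_kernel (κ := P) (f := ψ) hψ.stronglyMeasurable).measurable

/-- Iterating the drift adds the constants C η^j, whose geometric series sums to at most C / (1 -
η), whatever the number of steps. -/
theorem Drift.pow {P : Kernel X X} [IsMarkovKernel P] {η C : ℝ} (hV : Measurable V)
    (hV0 : ∀ x, 0 ≤ V x) (hη0 : 0 ≤ η) (hη : η < 1) (hC : 0 ≤ C) (h : Drift P V η C) (n : ℕ) :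
    Drift (P ^ n) V (η ^ n) (C / (1 - η)) := by
  have h1 : 0 < 1 - η := by linarith
  induction n with
  | zero =>
    intro x
    rw [pow_zero_kernel_apply]
    refine ⟨integrable_dirac' hV.stronglyMeasurable (by simp), ?_⟩
    rw [integral_dirac' _ _ hV.stronglyMeasurable]
    simp only [pow_zero, one_mul, le_add_iff_nonneg_right]
    positivity
  | succ n ih =>
    intro x
    have hle : ∀ y, ∫ z, V z ∂((P ^ 1) y) ≤ η * V y + C := by
      intro y; rw [pow_one]; exact (h y).2
    have hint : Integrable (fun y => η * V y + C) ((P ^ n) x) :=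
      ((ih x).1.const_mul η).add (integrable_const C)
    have hI : Integrable V ((P ^ (1 + n)) x) := by
      rw [Kernel.pow_add, ProbabilityTheory.integrable_comp_iff hV.aestronglyMeasurable]
      refine ⟨ae_of_all _ fun y => ?_, ?_⟩
      · rw [pow_one]; exact (h y).1
      · refine hint.mono' (measurable_integral_kernel _ hV.norm).aestronglyMeasurable
          (ae_of_all _ fun y => ?_)
        have he : ∀ z, ‖V z‖ = V z := fun z => by rw [Real.norm_eq_abs, abs_of_nonneg (hV0 z)]
        simp only [he]
        rw [Real.norm_eq_abs, abs_of_nonneg (integral_nonneg hV0)]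
        exact hle y
    rw [add_comm] at hI
    refine ⟨hI, ?_⟩
    rw [add_comm] at hI
    rw [add_comm n 1, integral_pow_add P 1 n hI]
    calc ∫ y, ∫ z, V z ∂((P ^ 1) y) ∂((P ^ n) x)
        ≤ ∫ y, (η * V y + C) ∂((P ^ n) x) :=
          integral_mono_of_nonneg (ae_of_all _ fun y => integral_nonneg hV0) hint
            (ae_of_all _ hle)
      _ = η * ∫ y, V y ∂((P ^ n) x) + C := by
          rw [integral_add ((ih x).1.const_mul η) (integrable_const C), integral_const_mul]
          simp
      _ ≤ η * (η ^ n * V x + C / (1 - η)) + C := by gcongr; exact (ih x).2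
      _ = η ^ (1 + n) * V x + C / (1 - η) := by
          rw [pow_add, pow_one]; field_simp; ring

/-- The intervals [u x - w x, u x + w x] meet pairwise, so the supremum of the left endpoints lies
in all of them. This passes from bounds on pairs of points to a single centre, the form in which the
contraction can be iterated. -/
theorem exists_center {X : Type*} [Nonempty X] {u w : X → ℝ}
    (h : ∀ x y, |u x - u y| ≤ w x + w y) : ∃ c, ∀ x, |u x - c| ≤ w x := by
  obtain ⟨x₀⟩ := ‹Nonempty X›
  have hb : BddAbove (range fun x => u x - w x) := by
    refine ⟨u x₀ + w x₀, ?_⟩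
    rintro _ ⟨x, rfl⟩
    have := (abs_le.1 (h x x₀)).2
    simp only
    linarith
  have : Nonempty X := ⟨x₀⟩
  refine ⟨⨆ x, (u x - w x), fun x => abs_le.2 ⟨?_, ?_⟩⟩
  · have : ⨆ x, (u x - w x) ≤ u x + w x := ciSup_le fun y => by
      have := (abs_le.1 (h y x)).2
      linarith
    linarith
  · have := le_ciSup hb x
    linarith

theorem abs_integral_le_weight {μ : Measure X} {ψ W : X → ℝ} (hW : Integrable W μ)
    (h : ∀ z, |ψ z| ≤ W z) : |∫ z, ψ z ∂μ| ≤ ∫ z, W z ∂μ :=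
  norm_integral_le_of_norm_le (f := ψ) hW (ae_of_all _ h)

/-- One step of the Hairer–Mattingly contraction in a weighted oscillation norm. -/
theorem exists_weighted_contraction {η C ε d : ℝ} (hη0 : 0 ≤ η) (hη : η < 1) (hC : 0 < C)
    (hε : 0 < ε) (hε1 : ε ≤ 1) (hd : 2 * C < (1 - η) * d) :
    ∃ β ρ : ℝ, 0 < β ∧ 0 < ρ ∧ ρ < 1 ∧
      ∀ {X : Type*} [MeasurableSpace X] [Nonempty X] {V : X → ℝ},
      Measurable V → (∀ x, 0 ≤ V x) →
      ∀ (Q : Kernel X X) [IsMarkovKernel Q] (μ : Measure X) [IsFiniteMeasure μ], Drift Q V η C →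
      ε ≤ μ.real univ → (∀ x, V x ≤ d → μ ≤ Q x) →
      ∀ (K : ℝ) (ψ : X → ℝ), 0 ≤ K → Measurable ψ → (∀ z, |ψ z| ≤ K * (1 + β * V z)) →
        ∃ c, ∀ x, |∫ z, ψ z ∂(Q x) - c| ≤ ρ * K * (1 + β * V x) := by
  have hd0 : 0 < d := by
    by_contra hneg
    have : (1 - η) * d ≤ 0 := mul_nonpos_of_nonneg_of_nonpos (by linarith) (by linarith)
    linarith
  -- The weight of `V` is chosen so that the drift constant costs 2βC = ε for a pair of points, half
  -- of the 2ε that the minorization gains.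
  set β := ε / (2 * C) with hβ
  have hβ0 : 0 < β := by positivity
  have hβC : 2 * β * C = ε := by rw [hβ]; field_simp
  -- The contraction ratio supplied by the drift alone when V x + V y = d; larger sums do better,
  -- and `hd` makes it less than 1.
  set ρ₁ := (2 + β * (η * d + 2 * C)) / (2 + β * d) with hρ₁
  have hden : 0 < 2 + β * d := by positivity
  have hρ₁1 : ρ₁ < 1 := by
    rw [hρ₁, div_lt_one hden]
    have : β * (η * d + 2 * C) < β * d := mul_lt_mul_of_pos_left (by linarith) hβ0
    linarith
  have hρ₁e : ρ₁ * (2 + β * d) = 2 + β * (η * d + 2 * C) := by rw [hρ₁]; field_simp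
  refine ⟨β, max (max (1 - ε / 2) η) ρ₁, hβ0, ?_, ?_, ?_⟩
  · exact lt_max_of_lt_left (lt_max_of_lt_left (by linarith))
  · exact max_lt (max_lt (by linarith) hη) hρ₁1
  intro X _ _ V hV hV0 Q _ μ _ hQ hμ hμQ K ψ hK hψ hψK
  set ρ := max (max (1 - ε / 2) η) ρ₁
  have hρa : 1 - ε / 2 ≤ ρ := le_max_of_le_left (le_max_left _ _)
  have hρb : η ≤ ρ := le_max_of_le_left (le_max_right _ _)
  have hρc : ρ₁ ≤ ρ := le_max_right _ _
  have hWint : ∀ x, Integrable (fun z => K * (1 + β * V z)) (Q x) := fun x =>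
    (((integrable_const 1).add ((hQ x).1.const_mul β)).const_mul K)
  have hWval : ∀ x, ∫ z, K * (1 + β * V z) ∂(Q x) ≤ K * (1 + β * (η * V x + C)) := fun x => by
    rw [integral_const_mul, integral_add (integrable_const 1) ((hQ x).1.const_mul β),
      integral_const_mul]
    simp only [integral_const, probReal_univ, smul_eq_mul, one_mul]
    have := (hQ x).2
    gcongr
  have hbound : ∀ x y, |∫ z, ψ z ∂(Q x) - ∫ z, ψ z ∂(Q y)| ≤
      K * (ρ * (2 + β * (V x + V y))) := by
    intro x y
    by_cases hxy : V x + V y ≤ d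
    -- Near pairs: both kernels contain μ, which cancels in the difference and removes at least K ε
    -- from each bound, because the weight is at least 1.
    · have hsplit : ∀ x, V x ≤ d → |∫ z, ψ z ∂(Q x) - ∫ z, ψ z ∂μ| ≤
          K * (1 + β * (η * V x + C)) - K * ε := by
        intro x hx
        have hQx : Q x = (Q x - μ) + μ := (Measure.sub_add_cancel_of_le (hμQ x hx)).symm
        have hμle := hμQ x hx
        have hWx := hWint x
        have hψi : Integrable ψ (Q x) := integrable_of_abs_le hWx hψ hψK
        have hsub : Q x - μ ≤ Q x := Measure.sub_le
        have e1 : ∫ z, ψ z ∂(Q x) = ∫ z, ψ z ∂(Q x - μ) + ∫ z, ψ z ∂μ := by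
          conv_lhs => rw [hQx]
          exact integral_add_measure (hψi.mono_measure hsub) (hψi.mono_measure hμle)
        have e2 : ∫ z, K * (1 + β * V z) ∂(Q x) =
            ∫ z, K * (1 + β * V z) ∂(Q x - μ) + ∫ z, K * (1 + β * V z) ∂μ := by
          conv_lhs => rw [hQx]
          exact integral_add_measure (hWx.mono_measure hsub) (hWx.mono_measure hμle)
        have e3 : K * ε ≤ ∫ z, K * (1 + β * V z) ∂μ := by
          calc K * ε ≤ K * μ.real univ := by gcongr
            _ = ∫ _, K ∂μ := by rw [integral_const, smul_eq_mul, mul_comm]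
            _ ≤ _ := integral_mono (integrable_const K) (hWx.mono_measure hμle) fun z => by
              have := mul_nonneg hβ0.le (hV0 z)
              simp only
              nlinarith
        have e4 := abs_integral_le_weight (hWx.mono_measure hsub) hψK
        rw [e1, add_sub_cancel_right]
        have := hWval x
        linarith
      have hx := hsplit x (by linarith [hV0 y])
      have hy := hsplit y (by linarith [hV0 x])
      rw [abs_sub_comm] at hy
      have htri := abs_sub_le (∫ z, ψ z ∂(Q x)) (∫ z, ψ z ∂μ) (∫ z, ψ z ∂(Q y))
      have hmain : 2 - 2 * ε + β * η * (V x + V y) + 2 * β * C ≤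
          ρ * (2 + β * (V x + V y)) := by
        have : η * (β * (V x + V y)) ≤ ρ * (β * (V x + V y)) :=
          mul_le_mul_of_nonneg_right hρb (mul_nonneg hβ0.le (add_nonneg (hV0 x) (hV0 y)))
        linarith
      have := mul_le_mul_of_nonneg_left hmain hK
      linarith
    · have hx := (abs_integral_le_weight (hWint x) hψK).trans (hWval x)
      have hy := (abs_integral_le_weight (hWint y) hψK).trans (hWval y)
      have htri := abs_sub (∫ z, ψ z ∂(Q x)) (∫ z, ψ z ∂(Q y))
      have hηρ : η ≤ ρ₁ := by
        rw [hρ₁, le_div_iff₀ hden]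
        have : 0 < β * C := by positivity
        nlinarith
      have hmain : 2 + β * (η * (V x + V y) + 2 * C) ≤ ρ₁ * (2 + β * (V x + V y)) := by
        have h1 : 0 ≤ (ρ₁ - η) * (β * (V x + V y - d)) :=
          mul_nonneg (by linarith) (mul_nonneg hβ0.le (by linarith))
        linarith
      have hmain2 : ρ₁ * (2 + β * (V x + V y)) ≤ ρ * (2 + β * (V x + V y)) :=
        mul_le_mul_of_nonneg_right hρc
          (by have := mul_nonneg hβ0.le (add_nonneg (hV0 x) (hV0 y)); linarith)
      have := mul_le_mul_of_nonneg_left (hmain.trans hmain2) hK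
      linarith
  apply exists_center
  intro x y
  refine (hbound x y).trans (le_of_eq ?_)
  ring

/-- Geometric decay of oscillations, with constants that are uniform over all kernels with the
same drift and minorization constants. -/
theorem exists_geometric_oscillation {η C ε d : ℝ} {N : ℕ} (hN : 1 ≤ N) (hη0 : 0 ≤ η)
    (hη : η < 1) (hC : 0 < C) (hε : 0 < ε) (hε1 : ε ≤ 1)
    (hd : 2 * (C / (1 - η)) < (1 - η) * d) :
    ∃ R γ : ℝ, 0 < R ∧ 0 < γ ∧ γ < 1 ∧
      ∀ {X : Type*} [MeasurableSpace X] [Nonempty X] {V : X → ℝ},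
      Measurable V → (∀ x, 1 ≤ V x) →
      ∀ (P : Kernel X X) [IsMarkovKernel P] (μ : Measure X) [IsFiniteMeasure μ], Drift P V η C →
      ε ≤ μ.real univ → (∀ x, V x ≤ d → μ ≤ (P ^ N) x) →
      ∀ ψ : X → ℝ, Measurable ψ → (∀ z, |ψ z| ≤ V z) →
        ∀ n : ℕ, ∃ c, ∀ x, |∫ z, ψ z ∂((P ^ n) x) - c| ≤ R * γ ^ n * V x := by
  have h1η : 0 < 1 - η := by linarith
  have hC' : 0 < C / (1 - η) := by positivity
  obtain ⟨β, ρ, hβ, hρ0, hρ1, hcontr⟩ := exists_weighted_contraction hη0 hη hC' hε hε1 hd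
  set C' := C / (1 - η) with hC'def
  -- Chosen so that V + C' ≤ K (1 + β V): every iterate of a function bounded by `V` starts the
  -- contraction with the same constant.
  set K := (1 + C') / β with hK
  have hK0 : 0 < K := by positivity
  set γ := ρ ^ ((1 : ℝ) / N) with hγ
  have hN0 : (0 : ℝ) < N := by exact_mod_cast hN
  have hγ0 : 0 < γ := Real.rpow_pos_of_pos hρ0 _
  have hγ1 : γ < 1 := Real.rpow_lt_one hρ0.le hρ1 (by positivity)
  have hγN : γ ^ N = ρ := by
    rw [hγ, ← Real.rpow_natCast, ← Real.rpow_mul hρ0.le, one_div, inv_mul_cancel₀ hN0.ne',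
      Real.rpow_one]
  refine ⟨K / ρ * (1 + β), γ, by positivity, hγ0, hγ1, ?_⟩
  intro X _ _ V hV hV1 P _ μ _ hP hμ hμP ψ hψ hψV n
  have hV0 : ∀ x, 0 ≤ V x := fun x => zero_le_one.trans (hV1 x)
  have hpow : ∀ n, Drift (P ^ n) V (η ^ n) C' := fun n => hP.pow hV hV0 hη0 hη hC.le n
  have hDN : Drift (P ^ N) V η C' := fun x => by
    refine ⟨(hpow N x).1, (hpow N x).2.trans ?_⟩
    have : η ^ N ≤ η := pow_le_of_le_one hη0 hη.le (by omega)
    gcongr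
    exact hV0 x
  have hψint : ∀ n x, Integrable ψ ((P ^ n) x) := fun n x =>
    integrable_of_abs_le (hpow n x).1 hψ hψV
  have hsmall : ∀ j x, |∫ z, ψ z ∂((P ^ j) x)| ≤ K * (1 + β * V x) := fun j x => by
    refine (abs_integral_le_weight (hpow j x).1 hψV).trans ((hpow j x).2.trans ?_)
    have h1 : η ^ j * V x ≤ V x :=
      mul_le_of_le_one_left (hV0 x) (pow_le_one₀ hη0 hη.le)
    have h2 : K * (1 + β * V x) = K + (1 + C') * V x := by rw [hK]; field_simp
    have h3 : C' * 1 ≤ C' * V x := mul_le_mul_of_nonneg_left (hV1 x) hC'.le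
    rw [h2]
    linarith
  have hiter : ∀ k j, ∃ c, ∀ x, |∫ z, ψ z ∂((P ^ (j + N * k)) x) - c| ≤
      ρ ^ k * K * (1 + β * V x) := by
    intro k j
    induction k with
    | zero => exact ⟨0, fun x => by simpa using hsmall j x⟩
    | succ k ih =>
      obtain ⟨c, hc⟩ := ih
      have hmeas : Measurable fun x => ∫ z, ψ z ∂((P ^ (j + N * k)) x) :=
        measurable_integral_kernel _ hψ
      obtain ⟨c', hc'⟩ := hcontr hV hV0 (P ^ N) μ hDN hμ hμP (ρ ^ k * K)
        (fun x => ∫ z, ψ z ∂((P ^ (j + N * k)) x) - c) (by positivity) (hmeas.sub_const c) hc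
      refine ⟨c' + c, fun x => ?_⟩
      have hint : Integrable (fun y => ∫ z, ψ z ∂((P ^ (j + N * k)) y)) ((P ^ N) x) :=
        integrable_of_abs_le (W := fun y => K * (1 + β * V y))
          (((integrable_const 1).add ((hpow N x).1.const_mul β)).const_mul K) hmeas
          (fun y => hsmall _ y)
      have he : ∫ z, ψ z ∂((P ^ (j + N * (k + 1))) x) =
          ∫ y, (∫ z, ψ z ∂((P ^ (j + N * k)) y) - c) ∂((P ^ N) x) + c := by
        rw [integral_sub hint (integrable_const c), mul_add, mul_one, ← add_assoc,
          integral_pow_add P _ N]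
        · simp
        · exact hψint _ x
      have := hc' x
      rw [he, add_sub_add_right_eq_sub]
      refine this.trans (le_of_eq ?_)
      ring
  obtain ⟨c, hc⟩ := hiter (n / N) (n % N)
  refine ⟨c, fun x => ?_⟩
  have hn : n % N + N * (n / N) = n := Nat.mod_add_div n N
  rw [hn] at hc
  refine (hc x).trans ?_
  -- Contraction happens only once every N steps; rounding n down to a multiple of N costs at most
  -- one factor ρ.
  have h1 : ρ ^ (n / N) * ρ ≤ γ ^ n := by
    rw [← pow_succ, ← hγN, ← pow_mul]
    apply pow_le_pow_of_le_one hγ0.le hγ1.le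
    have := Nat.mod_lt n (show 0 < N by omega)
    rw [mul_add, mul_one]
    omega
  have h2 : 1 + β * V x ≤ (1 + β) * V x := by linarith [hV1 x]
  have h3 : ρ ^ (n / N) ≤ γ ^ n / ρ := by rwa [le_div_iff₀ hρ0]
  calc ρ ^ (n / N) * K * (1 + β * V x) ≤ γ ^ n / ρ * K * ((1 + β) * V x) := by
        have := hV0 x
        gcongr
    _ = _ := by ring

end Harris

/-! ### Existence, uniqueness and moments of the invariant measure. -/

section Invariant

open Filter Topology

variable {X : Type*} [MeasurableSpace X] {V : X → ℝ}

/-- The oscillation bound produced by `exists_geometric_oscillation`. -/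
def GeometricOscillation (P : Kernel X X) (V : X → ℝ) (R γ : ℝ) : Prop :=
  ∀ ψ : X → ℝ, Measurable ψ → (∀ z, |ψ z| ≤ V z) →
    ∀ n : ℕ, ∃ c, ∀ x, |∫ z, ψ z ∂((P ^ n) x) - c| ≤ R * γ ^ n * V x

theorem invariant_pow {P : Kernel X X} {π : Measure X} (h : P.Invariant π) (n : ℕ) :
    (P ^ n).Invariant π := by
  induction n with
  | zero =>
    rw [pow_zero]
    exact Measure.id_comp
  | succ n ih => rw [pow_succ]; exact ih.comp h

theorem integral_bind_kernel {P : Kernel X X} {μ : Measure X} {ψ : X → ℝ}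
    (h : Integrable ψ (μ.bind P)) : ∫ z, ψ z ∂(μ.bind P) = ∫ y, ∫ z, ψ z ∂(P y) ∂μ := by
  have he : μ.bind P = (P ∘ₖ Kernel.const Unit μ) () := Measure.comp_eq_comp_const_apply
  rw [he] at h ⊢
  rw [Kernel.integral_comp h, Kernel.const_apply]

theorem integral_invariant {P : Kernel X X} {π : Measure X} (h : P.Invariant π) (n : ℕ)
    {ψ : X → ℝ} (hψ : Integrable ψ π) : ∫ z, ψ z ∂π = ∫ y, ∫ z, ψ z ∂((P ^ n) y) ∂π := by
  have hn : π.bind (P ^ n) = π := invariant_pow h n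
  conv_lhs => rw [← hn]
  exact integral_bind_kernel (by rwa [hn])

theorem integrable_and_integral_le {μ : Measure X} {W : X → ℝ} {B : ℝ} (hW : Measurable W)
    (hW0 : ∀ x, 0 ≤ W x) (hB : 0 ≤ B)
    (h : ∫⁻ x, ENNReal.ofReal (W x) ∂μ ≤ ENNReal.ofReal B) :
    Integrable W μ ∧ ∫ x, W x ∂μ ≤ B := by
  have hi : Integrable W μ := by
    refine ⟨hW.aestronglyMeasurable, ?_⟩
    rw [hasFiniteIntegral_iff_ofReal (ae_of_all _ hW0)]
    exact h.trans_lt ENNReal.ofReal_lt_top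
  refine ⟨hi, ?_⟩
  rw [integral_eq_lintegral_of_nonneg_ae (ae_of_all _ hW0) hW.aestronglyMeasurable]
  exact ENNReal.toReal_le_of_le_ofReal hB h

/-- `V` is not known to be integrable for π, so the drift cannot be integrated directly. Truncation
at m makes it legitimate: by invariance and n drift steps the mean of min(V, m) is at most that of
min(η^n V + D, m). Dominated convergence in n and Fatou's lemma in m finish. -/
theorem integral_le_of_invariant {P : Kernel X X} [IsMarkovKernel P] {η C : ℝ}
    (hV : Measurable V) (hV0 : ∀ x, 0 ≤ V x) (hη0 : 0 ≤ η) (hη : η < 1) (hC : 0 ≤ C)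
    (h : Drift P V η C) {π : Measure X} [IsProbabilityMeasure π] (hπ : P.Invariant π) :
    Integrable V π ∧ ∫ x, V x ∂π ≤ C / (1 - η) := by
  set D := C / (1 - η) with hD
  have hD0 : 0 ≤ D := div_nonneg hC (by linarith)
  have htr : ∀ m : ℕ, ∫ z, min (V z) m ∂π ≤ D := by
    intro m
    have hmeas : Measurable fun z => min (V z) m := hV.min measurable_const
    have hbd : ∀ z, |min (V z) (m : ℝ)| ≤ m := fun z => by
      rw [abs_of_nonneg (le_min (hV0 z) (Nat.cast_nonneg m))]; exact min_le_right _ _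
    have hint : Integrable (fun z => min (V z) (m : ℝ)) π :=
      integrable_of_abs_le (integrable_const (m : ℝ)) hmeas hbd
    have hle : ∀ n : ℕ, ∫ z, min (V z) m ∂π ≤ ∫ z, min (η ^ n * V z + D) m ∂π := by
      intro n
      rw [integral_invariant hπ n hint]
      have hmin : Measurable fun z => min (η ^ n * V z + D) (m : ℝ) :=
        ((hV.const_mul _).add_const _).min measurable_const
      refine integral_mono_of_nonneg (ae_of_all _ fun y => integral_nonneg fun z =>
        le_min (hV0 z) (Nat.cast_nonneg m)) ?_ (ae_of_all _ fun y => le_min ?_ ?_)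
      · refine integrable_of_abs_le (integrable_const (m : ℝ)) hmin fun z => ?_
        rw [abs_of_nonneg (le_min (by have := hV0 z; positivity) (Nat.cast_nonneg m))]
        exact min_le_right _ _
      · refine le_trans ?_ ((h.pow hV hV0 hη0 hη hC n) y).2
        refine integral_mono (integrable_of_abs_le (integrable_const (m : ℝ)) hmeas hbd)
          ((h.pow hV hV0 hη0 hη hC n) y).1 fun z => min_le_left _ _
      · refine (le_abs_self _).trans
          ((abs_integral_le_weight (integrable_const (m : ℝ)) hbd).trans ?_)
        simp
    have hlim : Tendsto (fun n : ℕ => ∫ z, min (η ^ n * V z + D) m ∂π) atTop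
        (𝓝 (∫ _, min (0 * 0 + D) m ∂π)) := by
      refine tendsto_integral_of_dominated_convergence (fun _ => (m : ℝ)) (fun n =>
        (((hV.const_mul _).add_const _).min measurable_const).aestronglyMeasurable)
        (integrable_const _) (fun n => ae_of_all _ fun z => ?_) (ae_of_all _ fun z => ?_)
      · rw [Real.norm_eq_abs,
          abs_of_nonneg (le_min (by have := hV0 z; positivity) (Nat.cast_nonneg m))]
        exact min_le_right _ _
      · have := (tendsto_pow_atTop_nhds_zero_of_lt_one hη0 hη).mul_const (V z)
        rw [zero_mul] at this ⊢
        exact (this.add_const D).min tendsto_const_nhds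
    refine (ge_of_tendsto' hlim hle).trans ?_
    simp
  refine integrable_and_integral_le hV hV0 hD0 ?_
  have hfat : ∫⁻ x, ENNReal.ofReal (V x) ∂π ≤
      liminf (fun m : ℕ => ∫⁻ x, ENNReal.ofReal (min (V x) m) ∂π) atTop := by
    have heq : ∀ x, ENNReal.ofReal (V x) =
        liminf (fun m : ℕ => ENNReal.ofReal (min (V x) m)) atTop := by
      intro x
      refine (Tendsto.liminf_eq ?_).symm
      refine tendsto_const_nhds.congr' ?_
      filter_upwards [eventually_ge_atTop ⌈V x⌉₊] with m hm
      rw [min_eq_left ((Nat.le_ceil _).trans (by exact_mod_cast hm))]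
    simp_rw [heq]
    exact lintegral_liminf_le fun m => (hV.min measurable_const).ennreal_ofReal
  refine hfat.trans ?_
  refine (liminf_le_liminf (v := fun _ => ENNReal.ofReal D) (Eventually.of_forall fun m => ?_)).trans
    (by simp)
  have hmeas : Measurable fun z => min (V z) m := hV.min measurable_const
  have h0 : ∀ z, 0 ≤ min (V z) (m : ℝ) := fun z => le_min (hV0 z) (Nat.cast_nonneg m)
  rw [← ofReal_integral_eq_lintegral_ofReal (integrable_of_abs_le (integrable_const (m : ℝ)) hmeas
    fun z => by rw [abs_of_nonneg (h0 z)]; exact min_le_right _ _) (ae_of_all _ h0)]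
  exact ENNReal.ofReal_le_ofReal (htr m)

/-- The oscillation bound holds around an unknown centre c; integrating it against π shows that c is
itself close to the mean of ψ under π. -/
theorem GeometricOscillation.abs_sub_invariant_le {P : Kernel X X} [IsMarkovKernel P] {R γ : ℝ}
    (hosc : GeometricOscillation P V R γ)
    {π : Measure X} [IsProbabilityMeasure π] (hπ : P.Invariant π) (hVπ : Integrable V π)
    {ψ : X → ℝ} (hψ : Measurable ψ) (hψV : ∀ z, |ψ z| ≤ V z) (n : ℕ) (x : X) :
    |∫ z, ψ z ∂((P ^ n) x) - ∫ z, ψ z ∂π| ≤ R * γ ^ n * (V x + ∫ z, V z ∂π) := by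
  obtain ⟨c, hc⟩ := hosc ψ hψ hψV n
  have hψi : Integrable ψ π := integrable_of_abs_le hVπ hψ hψV
  have hmeas : Measurable fun y => ∫ z, ψ z ∂((P ^ n) y) := measurable_integral_kernel _ hψ
  have hVi : Integrable (fun y => R * γ ^ n * V y) π := hVπ.const_mul _
  have h1 : Integrable (fun y => ∫ z, ψ z ∂((P ^ n) y) - c) π :=
    integrable_of_abs_le hVi (hmeas.sub_const c) hc
  have h2 : Integrable (fun y => ∫ z, ψ z ∂((P ^ n) y)) π := by
    refine (h1.add (integrable_const c)).congr (ae_of_all _ fun y => ?_)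
    simp
  have h3 : |∫ z, ψ z ∂π - c| ≤ R * γ ^ n * ∫ z, V z ∂π := by
    rw [integral_invariant hπ n hψi, ← integral_const_mul]
    have : ∫ y, ∫ z, ψ z ∂((P ^ n) y) ∂π - c = ∫ y, (∫ z, ψ z ∂((P ^ n) y) - c) ∂π := by
      rw [integral_sub h2 (integrable_const c)]; simp
    rw [this]
    exact abs_integral_le_weight hVi hc
  have := abs_sub_le (∫ z, ψ z ∂((P ^ n) x)) c (∫ z, ψ z ∂π)
  rw [abs_sub_comm c] at this
  linarith [hc x]

theorem measure_eq_of_integral_indicator {μ ν : Measure X} [IsFiniteMeasure μ] [IsFiniteMeasure ν]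
    (h : ∀ A, MeasurableSet A → ∫ z, A.indicator (fun _ => (1 : ℝ)) z ∂μ =
      ∫ z, A.indicator (fun _ => (1 : ℝ)) z ∂ν) : μ = ν := by
  ext A hA
  have := h A hA
  rw [integral_indicator hA, integral_indicator hA] at this
  simp only [integral_const, smul_eq_mul, mul_one, measureReal_restrict_apply_univ] at this
  exact (measureReal_eq_measureReal_iff).1 this

theorem abs_indicator_one_le {X : Type*} (A : Set X) (z : X) : |A.indicator (fun _ => (1 : ℝ)) z| ≤ 1 := by
  by_cases h : z ∈ A <;> simp [h]

theorem GeometricOscillation.invariant_unique {P : Kernel X X} [IsMarkovKernel P] {R γ : ℝ}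
    (hosc : GeometricOscillation P V R γ) (hγ0 : 0 ≤ γ) (hγ : γ < 1) (hV1 : ∀ x, 1 ≤ V x)
    {π π' : Measure X} [IsProbabilityMeasure π] [IsProbabilityMeasure π'] (hπ : P.Invariant π)
    (hπ' : P.Invariant π') (hVπ : Integrable V π) (hVπ' : Integrable V π') : π = π' := by
  refine measure_eq_of_integral_indicator fun A hA => ?_
  have hmeas : Measurable (A.indicator fun _ => (1 : ℝ)) := measurable_const.indicator hA
  have hb : ∀ z, |A.indicator (fun _ => (1 : ℝ)) z| ≤ V z := fun z =>
    (abs_indicator_one_le A z).trans (hV1 z)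
  obtain ⟨x⟩ : Nonempty X := π.nonempty_of_neZero
  have hlim : ∀ (ρ : Measure X) [IsProbabilityMeasure ρ], P.Invariant ρ → Integrable V ρ →
      Tendsto (fun n => ∫ z, A.indicator (fun _ => (1 : ℝ)) z ∂((P ^ n) x)) atTop
        (𝓝 (∫ z, A.indicator (fun _ => (1 : ℝ)) z ∂ρ)) := by
    intro ρ _ hρ hVρ
    rw [tendsto_iff_norm_sub_tendsto_zero]
    refine squeeze_zero (fun _ => norm_nonneg _)
      (fun n => hosc.abs_sub_invariant_le hρ hVρ hmeas hb n x) ?_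
    have := ((tendsto_pow_atTop_nhds_zero_of_lt_one hγ0 hγ).const_mul R).mul_const
      (V x + ∫ z, V z ∂ρ)
    simpa using this
  exact tendsto_nhds_unique (hlim π hπ hVπ) (hlim π' hπ' hVπ')

/-- The oscillation bound makes the laws of the chain from a fixed point Cauchy in total variation.
Absolute continuity turns this into L¹ convergence of densities, so completeness of L¹ yields the
limit without any topology on the state space. -/
theorem GeometricOscillation.exists_invariant_density [Nonempty X] {P : Kernel X X}
    [IsMarkovKernel P] {R γ η C : ℝ} (hosc : GeometricOscillation P V R γ) (hR : 0 ≤ R)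
    (hγ0 : 0 ≤ γ) (hγ : γ < 1)
    (hV : Measurable V) (hV1 : ∀ x, 1 ≤ V x) (hη0 : 0 ≤ η) (hη : η < 1) (hC : 0 ≤ C)
    (hdrift : Drift P V η C) (ref : Measure X) [SigmaFinite ref] (hac : ∀ x, P x ≪ ref) :
    ∃ p : X → ℝ≥0, Measurable p ∧ IsProbabilityMeasure (ref.withDensity fun x => (p x : ℝ≥0∞)) ∧
      P.Invariant (ref.withDensity fun x => (p x : ℝ≥0∞)) := by
  have hV0 : ∀ x, 0 ≤ V x := fun x => zero_le_one.trans (hV1 x)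
  obtain ⟨x₀⟩ := ‹Nonempty X›
  set D := C / (1 - η) with hD
  have hD0 : 0 ≤ D := div_nonneg hC (by linarith)
  -- The exponent starts at 1: the law at time 0 is a Dirac mass, which need not have a density.
  set a : ℕ → Measure X := fun n => (P ^ (n + 1)) x₀ with ha
  have haac : ∀ n, a n ≪ ref := fun n => by
    refine Measure.AbsolutelyContinuous.mk fun s hs h0 => ?_
    simp only [ha]
    rw [Kernel.pow_succ_apply_eq_lintegral _ _ _ hs]
    simp [hac _ h0]
  set p : ℕ → X → ℝ := fun n z => ((a n).rnDeriv ref z).toReal with hp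
  have hpint : ∀ n, Integrable (p n) ref := fun n => Measure.integrable_toReal_rnDeriv
  have hpψ : ∀ n (ψ : X → ℝ), ∫ z, p n z * ψ z ∂ref = ∫ z, ψ z ∂(a n) := fun n ψ =>
    integral_toReal_rnDeriv_mul (haac n)
  have hcauchy : ∀ (ψ : X → ℝ), Measurable ψ → (∀ z, |ψ z| ≤ 1) → ∀ N n m : ℕ, N ≤ n → N ≤ m →
      |∫ z, ψ z ∂(a n) - ∫ z, ψ z ∂(a m)| ≤ 2 * R * (V x₀ + D) * γ ^ N := by
    intro ψ hψ hψ1 N n m hn hm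
    obtain ⟨c, hc⟩ := hosc ψ hψ (fun z => (hψ1 z).trans (hV1 z)) N
    -- The last N steps bring every starting point close to the same c; the steps before them only
    -- supply an initial law with a bounded mean of `V`.
    have key : ∀ k, N ≤ k → |∫ z, ψ z ∂(a k) - c| ≤ R * (V x₀ + D) * γ ^ N := by
      intro k hk
      obtain ⟨j, hj⟩ := Nat.exists_eq_add_of_le (Nat.le_succ_of_le hk)
      have hd := hdrift.pow hV hV0 hη0 hη hC j x₀
      have hVi : Integrable (fun y => R * γ ^ N * V y) ((P ^ j) x₀) := hd.1.const_mul _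
      have hmeas : Measurable fun y => ∫ z, ψ z ∂((P ^ N) y) := measurable_integral_kernel _ hψ
      have h1 : Integrable (fun y => ∫ z, ψ z ∂((P ^ N) y) - c) ((P ^ j) x₀) :=
        integrable_of_abs_le hVi (hmeas.sub_const c) hc
      have h2 : Integrable (fun y => ∫ z, ψ z ∂((P ^ N) y)) ((P ^ j) x₀) := by
        refine (h1.add (integrable_const c)).congr (ae_of_all _ fun y => ?_)
        simp
      have e : ∫ z, ψ z ∂(a k) - c = ∫ y, (∫ z, ψ z ∂((P ^ N) y) - c) ∂((P ^ j) x₀) := by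
        simp only [ha]
        rw [integral_sub h2 (integrable_const c), show k + 1 = N + j from hj, integral_pow_add]
        · simp
        · exact integrable_of_abs_le (integrable_const 1) hψ hψ1
      rw [e]
      refine (abs_integral_le_weight hVi hc).trans ?_
      rw [integral_const_mul]
      have hle : ∫ z, V z ∂((P ^ j) x₀) ≤ V x₀ + D := by
        refine hd.2.trans ?_
        have := mul_le_of_le_one_left (hV0 x₀) (pow_le_one₀ hη0 hη.le (n := j))
        linarith
      calc R * γ ^ N * ∫ z, V z ∂((P ^ j) x₀) ≤ R * γ ^ N * (V x₀ + D) := by gcongr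
        _ = _ := by ring
    have h1 := key n hn
    have h2 := key m hm
    rw [abs_sub_comm] at h2
    have := abs_sub_le (∫ z, ψ z ∂(a n)) c (∫ z, ψ z ∂(a m))
    linarith
  set B : ℝ := 2 * R * (V x₀ + D) with hB
  have hB0 : 0 ≤ B := by have := hV0 x₀; positivity
  -- The sign of p n - p m, as test function, turns the weak bound into an L¹ bound. The summand
  -- (1/2)^N makes the inequality strict while keeping the series summable.
  have hL1 : ∀ N n m : ℕ, N ≤ n → N ≤ m →
      eLpNorm (p n - p m) 1 ref < ENNReal.ofReal (B * γ ^ N + (1 / 2) ^ N) := by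
    intro N n m hn hm
    set ψ : X → ℝ := fun z => if p m z ≤ p n z then 1 else -1 with hψdef
    have hpm : ∀ n, Measurable (p n) := fun n => (Measure.measurable_rnDeriv _ _).ennreal_toReal
    have hψ : Measurable ψ :=
      Measurable.ite (measurableSet_le (hpm m) (hpm n)) measurable_const measurable_const
    have hψ1 : ∀ z, |ψ z| ≤ 1 := fun z => by
      simp only [hψdef]; split_ifs <;> simp
    have hi : ∀ n, Integrable (fun z => p n z * ψ z) ref := fun n =>
      (hpint n).mul_bdd hψ.aestronglyMeasurable (ae_of_all _ hψ1)
    have he : ∀ z, ‖(p n - p m) z‖ = p n z * ψ z - p m z * ψ z := fun z => by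
      simp only [hψdef, Pi.sub_apply, Real.norm_eq_abs]
      split_ifs with h
      · rw [abs_of_nonneg (by linarith)]; ring
      · rw [abs_of_neg (by linarith)]; ring
    rw [eLpNorm_one_eq_lintegral_enorm, ← ofReal_integral_norm_eq_lintegral_enorm
      ((hpint n).sub (hpint m))]
    simp_rw [he]
    rw [integral_sub (hi n) (hi m), hpψ, hpψ]
    have h1 := (le_abs_self _).trans (hcauchy ψ hψ hψ1 N n m hn hm)
    have h2 : (0 : ℝ) < (1 / 2) ^ N := by positivity
    exact (ENNReal.ofReal_lt_ofReal_iff (by positivity)).2 (by linarith)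
  have hsum : ∑' N : ℕ, ENNReal.ofReal (B * γ ^ N + (1 / 2) ^ N) ≠ ∞ := by
    have hs : Summable fun N : ℕ => B * γ ^ N + (1 / 2) ^ N :=
      ((summable_geometric_of_lt_one hγ0 hγ).mul_left B).add summable_geometric_two
    rw [← ENNReal.ofReal_tsum_of_nonneg (fun N => by positivity) hs]
    exact ENNReal.ofReal_ne_top
  obtain ⟨q, hq, hqlim⟩ := Lp.cauchy_complete_eLpNorm le_rfl
    (fun n => memLp_one_iff_integrable.2 (hpint n)) hsum hL1
  have hqi : Integrable q ref := memLp_one_iff_integrable.1 hq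
  have hlim : ∀ ψ : X → ℝ, Measurable ψ → (∀ z, |ψ z| ≤ 1) →
      Tendsto (fun n => ∫ z, ψ z ∂(a n)) atTop (𝓝 (∫ z, q z * ψ z ∂ref)) := by
    intro ψ hψ hψ1
    simp_rw [← hpψ]
    refine tendsto_integral_of_L1 _
      (hqi.aestronglyMeasurable.mul hψ.aestronglyMeasurable) (Eventually.of_forall fun n =>
      (hpint n).mul_bdd hψ.aestronglyMeasurable (ae_of_all _ hψ1)) ?_
    simp_rw [eLpNorm_one_eq_lintegral_enorm] at hqlim
    refine tendsto_of_tendsto_of_tendsto_of_le_of_le tendsto_const_nhds hqlim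
      (fun _ => zero_le) fun n => lintegral_mono fun z => ?_
    rw [Pi.mul_apply, ← sub_mul, enorm_mul, Pi.sub_apply]
    refine mul_le_of_le_one_right' ?_
    rw [Real.enorm_eq_ofReal_abs]
    exact ENNReal.ofReal_le_one.2 (hψ1 z)
  have hq0 : 0 ≤ᵐ[ref] q := by
    refine ae_nonneg_of_forall_setIntegral_nonneg hqi fun s hs _ => ?_
    have h1 := hlim (s.indicator fun _ => 1) (measurable_const.indicator hs)
      (abs_indicator_one_le s)
    have h2 : ∫ z, q z * s.indicator (fun _ => (1 : ℝ)) z ∂ref = ∫ z in s, q z ∂ref := by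
      rw [← integral_indicator hs]
      congr 1 with z
      by_cases hz : z ∈ s <;> simp [hz]
    rw [h2] at h1
    exact ge_of_tendsto' h1 fun n => integral_nonneg fun z => indicator_nonneg (by simp) z
  set g : X → ℝ≥0 := fun z => (hqi.aestronglyMeasurable.mk q z).toNNReal with hg
  have hgm : Measurable g :=
    hqi.aestronglyMeasurable.stronglyMeasurable_mk.measurable.real_toNNReal
  have hgq : ∀ᵐ z ∂ref, (g z : ℝ) = q z := by
    filter_upwards [hq0, hqi.aestronglyMeasurable.ae_eq_mk] with z h1 h2
    simp only [hg]
    rw [← h2, Real.coe_toNNReal _ h1]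
  set π := ref.withDensity fun x => (g x : ℝ≥0∞) with hπ
  have hπψ : ∀ ψ : X → ℝ, ∫ z, ψ z ∂π = ∫ z, q z * ψ z ∂ref := by
    intro ψ
    rw [hπ, integral_withDensity_eq_integral_smul hgm]
    refine integral_congr_ae ?_
    filter_upwards [hgq] with z hz
    rw [NNReal.smul_def, hz, smul_eq_mul]
  simp_rw [← hπψ] at hlim
  have hprob : IsProbabilityMeasure π := by
    have h1 := hlim (fun _ => 1) measurable_const (by simp)
    simp only [integral_const, smul_eq_mul, mul_one] at h1
    have h2 : ∀ n, (a n).real univ = 1 := fun n => by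
      simp only [ha]; exact probReal_univ
    simp only [h2] at h1
    have h3 : π.real univ = 1 := tendsto_nhds_unique h1 tendsto_const_nhds
    exact ⟨(ENNReal.toReal_eq_one_iff _).1 h3⟩
  refine ⟨g, hgm, hprob, ?_⟩
  refine measure_eq_of_integral_indicator fun A hA => ?_
  set ψ : X → ℝ := A.indicator fun _ => 1
  have hψ : Measurable ψ := measurable_const.indicator hA
  have hψ1 : ∀ z, |ψ z| ≤ 1 := abs_indicator_one_le A
  have hi : ∀ (μ : Measure X) [IsProbabilityMeasure μ], Integrable ψ μ := fun μ _ =>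
    integrable_of_abs_le (integrable_const 1) hψ hψ1
  rw [integral_bind_kernel (hi _)]
  -- Testing `a n` against Pψ equals testing `a (n + 1)` against ψ, so both sides of the invariance
  -- equation are limits of one sequence.
  have h1 := hlim (fun y => ∫ z, ψ z ∂(P y)) (measurable_integral_kernel P hψ) fun y =>
    (abs_integral_le_weight (integrable_const 1) hψ1).trans (by simp)
  have h2 := (tendsto_add_atTop_iff_nat 1).2 (hlim ψ hψ hψ1)
  refine tendsto_nhds_unique h1 (h2.congr fun n => ?_)
  simp only [ha]
  rw [show n + 1 + 1 = 1 + (n + 1) by ring, integral_pow_add P 1 (n + 1) (hi _)]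
  simp

end Invariant

/-! ### Bias and variance of ergodic averages of a Markov chain. -/

section Chain

variable {X Ω : Type*} [MeasurableSpace X] [MeasurableSpace Ω] {V : X → ℝ}

/-- `Z` is a Markov chain with transition kernel `K` started at `x₀`. -/
structure IsMarkovChain (P : Measure Ω) (K : Kernel X X) (x₀ : X) (Z : ℕ → Ω → X) : Prop where
  measurable : ∀ k, Measurable (Z k)
  init : ∀ᵐ ω ∂P, Z 0 ω = x₀
  transition : ∀ k, HasCondDistrib (Z (k + 1)) (fun ω (i : Finset.Iic k) => Z i ω)
    (K.comap (fun h : Finset.Iic k → X => h ⟨k, by simp⟩) (measurable_pi_apply _)) P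

theorem integrable_of_bdd {Y : Type*} [MeasurableSpace Y] {μ : Measure Y} [IsFiniteMeasure μ]
    {ψ : Y → ℝ} {S : ℝ} (hψ : Measurable ψ) (h : ∀ z, |ψ z| ≤ S) : Integrable ψ μ :=
  integrable_of_abs_le (integrable_const S) hψ h

variable {P : Measure Ω} [IsProbabilityMeasure P] {K : Kernel X X} [IsMarkovKernel K] {x₀ : X}
  {Z : ℕ → Ω → X}

theorem abs_integral_kernel_le {ψ : X → ℝ} {S : ℝ} (hS : ∀ z, |ψ z| ≤ S) (x : X) :
    |∫ z, ψ z ∂(K x)| ≤ S :=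
  (abs_integral_le_weight (integrable_const S) hS).trans (by simp)

/-- The Markov property, projected from the whole past to the pair (Z j, Z k), is all that
covariances require. -/
theorem IsMarkovChain.integral_mul_succ (hZ : IsMarkovChain P K x₀ Z) {u ψ : X → ℝ} {S S' : ℝ}
    (hu : Measurable u) (hψ : Measurable ψ) (huS : ∀ z, |u z| ≤ S) (hψS : ∀ z, |ψ z| ≤ S')
    {j k : ℕ} (hjk : j ≤ k) :
    ∫ ω, u (Z j ω) * ψ (Z (k + 1) ω) ∂P = ∫ ω, u (Z j ω) * ∫ z, ψ z ∂(K (Z k ω)) ∂P := by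
  have hmZ := hZ.measurable
  set π : (Finset.Iic k → X) → X × X := fun h => (h ⟨j, by simpa using hjk⟩, h ⟨k, by simp⟩)
  have hπ : Measurable π := by fun_prop
  have hcond : HasCondDistrib (Z (k + 1)) (fun ω => (Z j ω, Z k ω))
      (K.comap Prod.snd measurable_snd) P :=
    HasCondDistrib.comp_right (f := π) (hf := hπ) (κ := K.comap Prod.snd measurable_snd)
      (hZ.transition k)
  have hF : Measurable fun p : (X × X) × X => u p.1.1 * ψ p.2 := by fun_prop
  have hFb : ∀ p : (X × X) × X, |u p.1.1 * ψ p.2| ≤ S * S' := fun p => by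
    rw [abs_mul]
    exact mul_le_mul (huS _) (hψS _) (abs_nonneg _) ((abs_nonneg _).trans (huS p.1.1))
  have hpair : Measurable fun ω => (Z j ω, Z k ω) := (hmZ j).prodMk (hmZ k)
  have := Measure.isProbabilityMeasure_map hpair.aemeasurable (μ := P)
  calc ∫ ω, u (Z j ω) * ψ (Z (k + 1) ω) ∂P
      = ∫ p, u p.1.1 * ψ p.2 ∂(P.map fun ω => ((Z j ω, Z k ω), Z (k + 1) ω)) :=
        (integral_map (hpair.prodMk (hmZ _)).aemeasurable hF.aestronglyMeasurable).symm
    _ = ∫ p, u p.1.1 * ψ p.2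
          ∂((P.map fun ω => (Z j ω, Z k ω)) ⊗ₘ K.comap Prod.snd measurable_snd) := by
        rw [hcond.map_eq]
    _ = ∫ q, ∫ z, u q.1 * ψ z ∂(K q.2) ∂(P.map fun ω => (Z j ω, Z k ω)) :=
        Measure.integral_compProd (integrable_of_bdd hF hFb)
    _ = ∫ q, u q.1 * ∫ z, ψ z ∂(K q.2) ∂(P.map fun ω => (Z j ω, Z k ω)) := by
        simp_rw [integral_const_mul]
    _ = _ := integral_map hpair.aemeasurable
        ((hu.comp measurable_fst).mul
          ((measurable_integral_kernel K hψ).comp measurable_snd)).aestronglyMeasurable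

theorem IsMarkovChain.integral_mul_add (hZ : IsMarkovChain P K x₀ Z) {u : X → ℝ} {S : ℝ}
    (hu : Measurable u) (huS : ∀ z, |u z| ≤ S) (j i : ℕ) {ψ : X → ℝ} {S' : ℝ}
    (hψ : Measurable ψ) (hψS : ∀ z, |ψ z| ≤ S') :
    ∫ ω, u (Z j ω) * ψ (Z (j + i) ω) ∂P = ∫ ω, u (Z j ω) * ∫ z, ψ z ∂((K ^ i) (Z j ω)) ∂P := by
  induction i generalizing ψ with
  | zero =>
    simp_rw [pow_zero_kernel_apply, integral_dirac' _ _ hψ.stronglyMeasurable, add_zero]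
  | succ i ih =>
    rw [← add_assoc, hZ.integral_mul_succ hu hψ huS hψS (Nat.le_add_right j i),
      ih (measurable_integral_kernel K hψ) (abs_integral_kernel_le hψS)]
    congr 1 with ω
    rw [add_comm i 1, integral_pow_add K 1 i (integrable_of_bdd hψ hψS), pow_one]

theorem IsMarkovChain.map_eq (hZ : IsMarkovChain P K x₀ Z) (k : ℕ) :
    P.map (Z k) = (K ^ k) x₀ := by
  have := Measure.isProbabilityMeasure_map (hZ.measurable k).aemeasurable (μ := P)
  refine measure_eq_of_integral_indicator fun A hA => ?_
  have hψ : Measurable (A.indicator fun _ => (1 : ℝ)) := measurable_const.indicator hA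
  have h := hZ.integral_mul_add (u := fun _ => 1) (S := 1) measurable_const (by simp) 0 k hψ
    (abs_indicator_one_le A)
  simp only [one_mul, zero_add] at h
  rw [integral_map (hZ.measurable k).aemeasurable hψ.aestronglyMeasurable, h]
  have he : (fun ω => ∫ z, A.indicator (fun _ => (1 : ℝ)) z ∂((K ^ k) (Z 0 ω))) =ᵐ[P]
      fun _ => ∫ z, A.indicator (fun _ => (1 : ℝ)) z ∂((K ^ k) x₀) := by
    filter_upwards [hZ.init] with ω hω
    rw [hω]
  rw [integral_congr_ae he]
  simp

/-- Weighted geometric ergodicity of `K` with invariant measure `π`. -/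
def GeometricErgodicity (K : Kernel X X) (π : Measure X) (V : X → ℝ) (R γ : ℝ) : Prop :=
  ∀ (k : ℕ) (x : X), Integrable V ((K ^ k) x) ∧ ∀ ψ : X → ℝ, Measurable ψ → (∀ z, |ψ z| ≤ V z) →
    |∫ z, ψ z ∂((K ^ k) x) - ∫ z, ψ z ∂π| ≤ R * V x * γ ^ k

theorem GeometricErgodicity.abs_sub_le {K : Kernel X X} {π : Measure X} {R γ : ℝ}
    (h : GeometricErgodicity K π V R γ) {ψ : X → ℝ} {S : ℝ} (hS : 0 ≤ S) (hψ : Measurable ψ)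
    (hψS : ∀ z, |ψ z| ≤ S * V z) (k : ℕ) (x : X) :
    |∫ z, ψ z ∂((K ^ k) x) - ∫ z, ψ z ∂π| ≤ S * (R * V x * γ ^ k) := by
  rcases hS.eq_or_lt with rfl | hS
  · have : ∀ z, ψ z = 0 := fun z => by simpa using hψS z
    simp [this]
  · have h1 := (h k x).2 (fun z => S⁻¹ * ψ z) (hψ.const_mul _) fun z => by
      rw [abs_mul, abs_of_pos (inv_pos.2 hS), inv_mul_le_iff₀ hS]
      exact hψS z
    rw [integral_const_mul, integral_const_mul, ← mul_sub, abs_mul, abs_of_pos (inv_pos.2 hS),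
      inv_mul_le_iff₀ hS] at h1
    exact h1

theorem sum_geometric_Icc_le {γ : ℝ} (hγ0 : 0 ≤ γ) (hγ : γ < 1) (n : ℕ) :
    ∑ k ∈ Finset.Icc 1 n, γ ^ k ≤ 1 / (1 - γ) := by
  rw [one_div, ← tsum_geometric_of_lt_one hγ0 hγ]
  exact (summable_geometric_of_lt_one hγ0 hγ).sum_le_tsum _ fun k _ => pow_nonneg hγ0 k

variable {π : Measure X} {R γ S : ℝ} {s : X → ℝ}

theorem IsMarkovChain.bias_le (hZ : IsMarkovChain P K x₀ Z) (h : GeometricErgodicity K π V R γ)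
    (hV1 : ∀ x, 1 ≤ V x) (hR : 0 ≤ R) (hγ0 : 0 ≤ γ) (hγ : γ < 1) (hs : Measurable s) (hS : 0 ≤ S)
    (hsS : ∀ z, |s z| ≤ S) {n : ℕ} (hn : 1 ≤ n) :
    |∫ ω, ((1 / n : ℝ) * ∑ k ∈ Finset.Icc 1 n, s (Z k ω) - ∫ x, s x ∂π) ∂P| ≤
      S * (R * V x₀ / (n * (1 - γ))) := by
  have hn0 : (0 : ℝ) < n := by exact_mod_cast hn
  have hint : ∀ k, Integrable (fun ω => s (Z k ω)) P := fun k =>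
    integrable_of_bdd (hs.comp (hZ.measurable k)) fun ω => hsS _
  have hmean : ∀ k, ∫ ω, s (Z k ω) ∂P = ∫ z, s z ∂((K ^ k) x₀) := fun k => by
    rw [← hZ.map_eq k, integral_map (hZ.measurable k).aemeasurable hs.aestronglyMeasurable]
  have hsV : ∀ z, |s z| ≤ S * V z := fun z =>
    (hsS z).trans (le_mul_of_one_le_right hS (hV1 z))
  have he : ∫ ω, ((1 / n : ℝ) * ∑ k ∈ Finset.Icc 1 n, s (Z k ω) - ∫ x, s x ∂π) ∂P =
      (1 / n : ℝ) * ∑ k ∈ Finset.Icc 1 n, (∫ z, s z ∂((K ^ k) x₀) - ∫ x, s x ∂π) := by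
    rw [integral_sub ((integrable_finsetSum _ fun k _ => hint k).const_mul _)
      (integrable_const _), integral_const_mul, integral_finsetSum _ fun k _ => hint k]
    simp only [hmean, Finset.sum_sub_distrib, integral_const, probReal_univ, one_smul,
      Finset.sum_const, Nat.card_Icc, Nat.add_sub_cancel, nsmul_eq_mul]
    field_simp
  rw [he, abs_mul, abs_of_pos (by positivity : (0 : ℝ) < 1 / n)]
  have hV0 : 0 ≤ V x₀ := zero_le_one.trans (hV1 x₀)
  calc (1 / n : ℝ) * |∑ k ∈ Finset.Icc 1 n, (∫ z, s z ∂((K ^ k) x₀) - ∫ x, s x ∂π)|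
      ≤ (1 / n : ℝ) * ∑ k ∈ Finset.Icc 1 n, S * (R * V x₀ * γ ^ k) := by
        gcongr
        exact (Finset.abs_sum_le_sum_abs _ _).trans
          (Finset.sum_le_sum fun k _ => h.abs_sub_le hS hs hsV k x₀)
    _ = (1 / n : ℝ) * (S * (R * V x₀)) * ∑ k ∈ Finset.Icc 1 n, γ ^ k := by
        rw [Finset.mul_sum, Finset.mul_sum]
        exact Finset.sum_congr rfl fun k _ => by ring
    _ ≤ (1 / n : ℝ) * (S * (R * V x₀)) * (1 / (1 - γ)) := by
        gcongr
        exact sum_geometric_Icc_le hγ0 hγ n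
    _ = _ := by
        have : 1 - γ ≠ 0 := by linarith
        field_simp

/-- Conditioning on Z k replaces s(Z (k + i)) by its conditional mean, which differs from the
stationary mean by at most S R V(Z k) γ^i. The remaining mean of |s| V at time k is compared with
its stationary value, which is possible because |s| V ≤ S V is itself an admissible test function.
-/
theorem IsMarkovChain.covariance_le (hZ : IsMarkovChain P K x₀ Z)
    (h : GeometricErgodicity K π V R γ) (hV : Measurable V)
    (hV1 : ∀ x, 1 ≤ V x) (hR : 0 ≤ R) (hγ0 : 0 ≤ γ) (hs : Measurable s) (hS : 0 ≤ S)
    (hsS : ∀ z, |s z| ≤ S) (k i : ℕ) :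
    cov[fun ω => s (Z k ω), fun ω => s (Z (k + i) ω); P] ≤
      S * R * γ ^ i * ∫ z, |s z| * V z ∂π + S ^ 2 * (R * V x₀ * (R + 1)) * γ ^ (k + i) := by
  have hmem : ∀ k, MemLp (fun ω => s (Z k ω)) 2 P := fun k =>
    MemLp.of_bound (hs.comp (hZ.measurable k)).aestronglyMeasurable S (ae_of_all _ fun ω => hsS _)
  have hV0 : ∀ x, 0 ≤ V x := fun x => zero_le_one.trans (hV1 x)
  have hsV : ∀ z, |s z| ≤ S * V z := fun z =>
    (hsS z).trans (le_mul_of_one_le_right hS (hV1 z))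
  have hmean : ∀ k, ∫ ω, s (Z k ω) ∂P = ∫ z, s z ∂((K ^ k) x₀) := fun k => by
    rw [← hZ.map_eq k, integral_map (hZ.measurable k).aemeasurable hs.aestronglyMeasurable]
  set m := ∫ ω, s (Z (k + i) ω) ∂P with hm
  set σ := ∫ z, s z ∂π with hσ
  have hmσ : |m - σ| ≤ S * (R * V x₀ * γ ^ (k + i)) := by
    rw [hm, hmean]
    exact h.abs_sub_le hS hs hsV _ _
  have hgmeas : Measurable fun y => ∫ z, s z ∂((K ^ i) y) := measurable_integral_kernel _ hs
  have hgb : ∀ y, |∫ z, s z ∂((K ^ i) y)| ≤ S := abs_integral_kernel_le hsS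
  have hbint : ∀ {ψ : X → ℝ} {B : ℝ} (_ : Measurable ψ) (_ : ∀ z, |ψ z| ≤ B),
      Integrable (fun ω => ψ (Z k ω)) P := fun hψ hb =>
    integrable_of_bdd (hψ.comp (hZ.measurable k)) fun ω => hb _
  have hcov : cov[fun ω => s (Z k ω), fun ω => s (Z (k + i) ω); P] =
      ∫ ω, s (Z k ω) * (∫ z, s z ∂((K ^ i) (Z k ω)) - m) ∂P := by
    rw [covariance_eq_sub (hmem k) (hmem (k + i))]
    simp_rw [mul_sub]
    rw [integral_sub, integral_mul_const, ← hZ.integral_mul_add hs hsS k i hs hsS]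
    · rfl
    · refine hbint (ψ := fun y => s y * ∫ z, s z ∂((K ^ i) y)) (B := S * S) (hs.mul hgmeas)
        fun z => ?_
      rw [abs_mul]
      exact mul_le_mul (hsS _) (hgb _) (abs_nonneg _) hS
    · exact (hbint hs hsS).mul_const m
  have hsVmeas : Measurable fun z => |s z| * V z := by fun_prop
  have hVk := (h k x₀).1
  have hsVint : Integrable (fun z => |s z| * V z) ((K ^ k) x₀) :=
    integrable_of_abs_le (hVk.const_mul S) hsVmeas fun z => by
      rw [abs_mul, abs_abs, abs_of_nonneg (hV0 z)]
      exact mul_le_mul_of_nonneg_right (hsS z) (hV0 z)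
  have hsVintP : Integrable (fun ω => |s (Z k ω)| * V (Z k ω)) P := by
    rw [← hZ.map_eq k] at hsVint
    exact hsVint.comp_measurable (hZ.measurable k)
  have hmeanV : ∫ ω, |s (Z k ω)| * V (Z k ω) ∂P ≤
      ∫ z, |s z| * V z ∂π + S * (R * V x₀ * γ ^ k) := by
    have h1 := h.abs_sub_le hS hsVmeas (fun z => by
      rw [abs_mul, abs_abs, abs_of_nonneg (hV0 z)]
      exact mul_le_mul_of_nonneg_right (hsS z) (hV0 z)) k x₀
    have h2 : ∫ z, |s z| * V z ∂((K ^ k) x₀) = ∫ ω, |s (Z k ω)| * V (Z k ω) ∂P := by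
      rw [← hZ.map_eq k, integral_map (hZ.measurable k).aemeasurable hsVmeas.aestronglyMeasurable]
    rw [h2] at h1
    linarith [(abs_le.1 h1).2]
  have hpt : ∀ ω, s (Z k ω) * (∫ z, s z ∂((K ^ i) (Z k ω)) - m) ≤
      S * R * γ ^ i * (|s (Z k ω)| * V (Z k ω)) + S ^ 2 * (R * V x₀ * γ ^ (k + i)) := by
    intro ω
    set z₀ := Z k ω
    have h1 := h.abs_sub_le hS hs hsV i z₀
    have h2 : |∫ z, s z ∂((K ^ i) z₀) - m| ≤
        S * (R * V z₀ * γ ^ i) + S * (R * V x₀ * γ ^ (k + i)) := by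
      have := abs_sub_le (∫ z, s z ∂((K ^ i) z₀)) σ m
      rw [abs_sub_comm σ] at this
      linarith
    have h3 : 0 ≤ S * (R * V x₀ * γ ^ (k + i)) := by have := hV0 x₀; positivity
    calc s z₀ * (∫ z, s z ∂((K ^ i) z₀) - m)
        ≤ |s z₀| * |∫ z, s z ∂((K ^ i) z₀) - m| := by
          rw [← abs_mul]; exact le_abs_self _
      _ ≤ |s z₀| * (S * (R * V z₀ * γ ^ i) + S * (R * V x₀ * γ ^ (k + i))) := by gcongr
      _ = S * R * γ ^ i * (|s z₀| * V z₀) + |s z₀| * (S * (R * V x₀ * γ ^ (k + i))) := by ring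
      _ ≤ S * R * γ ^ i * (|s z₀| * V z₀) + S * (S * (R * V x₀ * γ ^ (k + i))) := by
          gcongr
          exact hsS z₀
      _ = _ := by ring
  rw [hcov]
  calc ∫ ω, s (Z k ω) * (∫ z, s z ∂((K ^ i) (Z k ω)) - m) ∂P
      ≤ ∫ ω, (S * R * γ ^ i * (|s (Z k ω)| * V (Z k ω)) + S ^ 2 * (R * V x₀ * γ ^ (k + i))) ∂P := by
        refine integral_mono ?_ ((hsVintP.const_mul _).add (integrable_const _)) hpt
        refine hbint (ψ := fun y => s y * (∫ z, s z ∂((K ^ i) y) - m)) (B := S * (S + |m|))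
          (hs.mul (hgmeas.sub_const m)) fun z => ?_
        rw [abs_mul]
        refine mul_le_mul (hsS _) ((abs_sub _ _).trans ?_) (abs_nonneg _) hS
        gcongr
        exact hgb z
    _ = S * R * γ ^ i * ∫ ω, |s (Z k ω)| * V (Z k ω) ∂P + S ^ 2 * (R * V x₀ * γ ^ (k + i)) := by
        rw [integral_add (hsVintP.const_mul _) (integrable_const _), integral_const_mul]
        simp
    _ ≤ S * R * γ ^ i * (∫ z, |s z| * V z ∂π + S * (R * V x₀ * γ ^ k)) +
          S ^ 2 * (R * V x₀ * γ ^ (k + i)) := by gcongr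
    _ = _ := by rw [pow_add]; ring

theorem IsMarkovChain.variance_le (hZ : IsMarkovChain P K x₀ Z)
    (h : GeometricErgodicity K π V R γ)
    (hV1 : ∀ x, 1 ≤ V x) (hs : Measurable s) (hsS : ∀ z, |s z| ≤ S) (k : ℕ) :
    Var[fun ω => s (Z k ω); P] ≤ ∫ z, s z ^ 2 ∂π + S ^ 2 * (R * V x₀ * γ ^ k) := by
  have hs2 : Measurable fun z => s z ^ 2 := hs.pow_const 2
  have h1 := h.abs_sub_le (ψ := fun z => s z ^ 2) (sq_nonneg S) hs2 (fun z => by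
    rw [abs_of_nonneg (sq_nonneg _), ← sq_abs]
    exact (pow_le_pow_left₀ (abs_nonneg _) (hsS z) 2).trans
      (le_mul_of_one_le_right (sq_nonneg S) (hV1 z))) k x₀
  have h2 : ∫ z, s z ^ 2 ∂((K ^ k) x₀) = ∫ ω, s (Z k ω) ^ 2 ∂P := by
    rw [← hZ.map_eq k, integral_map (hZ.measurable k).aemeasurable hs2.aestronglyMeasurable]
  have h3 : Var[fun ω => s (Z k ω); P] ≤ ∫ ω, s (Z k ω) ^ 2 ∂P :=
    variance_le_expectation_sq (hs.comp (hZ.measurable k)).aestronglyMeasurable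
  rw [h2] at h1
  linarith [(abs_le.1 h1).2]

/-- Induction on n: a new term brings its own variance and twice its covariances with the earlier
ones. Partial sums are kept in the last term so that the increments match exactly. -/
theorem IsMarkovChain.variance_sum_le (hZ : IsMarkovChain P K x₀ Z)
    (h : GeometricErgodicity K π V R γ) (hV : Measurable V)
    (hV1 : ∀ x, 1 ≤ V x) (hR : 0 ≤ R) (hγ0 : 0 ≤ γ) (hγ : γ < 1) (hs : Measurable s) (hS : 0 ≤ S)
    (hsS : ∀ z, |s z| ≤ S) (n : ℕ) :
    Var[fun ω => ∑ k ∈ Finset.Icc 1 n, s (Z k ω); P] ≤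
      n * ∫ z, s z ^ 2 ∂π + n * S * (2 * R / (1 - γ)) * ∫ z, |s z| * V z ∂π +
        S ^ 2 * (R * V x₀ * ∑ k ∈ Finset.Icc 1 n, γ ^ k +
          2 * (R * V x₀ * (R + 1)) * ∑ k ∈ Finset.Icc 1 n, k * γ ^ k) := by
  have hmem : ∀ k, MemLp (fun ω => s (Z k ω)) 2 P := fun k =>
    MemLp.of_bound (hs.comp (hZ.measurable k)).aestronglyMeasurable S (ae_of_all _ fun ω => hsS _)
  have hV0 : ∀ x, 0 ≤ V x := fun x => zero_le_one.trans (hV1 x)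
  set A := ∫ z, |s z| * V z ∂π with hA
  have hA0 : 0 ≤ A := integral_nonneg fun z => mul_nonneg (abs_nonneg _) (hV0 z)
  set B := R * V x₀ * (R + 1) with hB
  have hB0 : 0 ≤ B := by have := hV0 x₀; positivity
  induction n with
  | zero =>
    have : Var[fun _ : Ω => (0 : ℝ); P] = 0 := variance_zero P
    simp [this]
  | succ n ih =>
    have hfun : (fun ω => ∑ k ∈ Finset.Icc 1 (n + 1), s (Z k ω)) =
        fun ω => (∑ k ∈ Finset.Icc 1 n, s (Z k ω)) + s (Z (n + 1) ω) := by
      funext ω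
      rw [Finset.sum_Icc_succ_top (by omega)]
    rw [hfun, variance_fun_add (memLp_finsetSum _ fun k _ => hmem k) (hmem _),
      covariance_fun_sum_left' (fun k _ => hmem k) (hmem _), Finset.sum_Icc_succ_top (by omega),
      Finset.sum_Icc_succ_top (by omega)]
    have hcov : ∑ k ∈ Finset.Icc 1 n, cov[fun ω => s (Z k ω), fun ω => s (Z (n + 1) ω); P] ≤
        S * R * (1 / (1 - γ)) * A + S ^ 2 * B * (((n + 1 : ℕ) : ℝ) * γ ^ (n + 1)) := by
      have hterm : ∀ k ∈ Finset.Icc 1 n,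
          cov[fun ω => s (Z k ω), fun ω => s (Z (n + 1) ω); P] ≤
            S * R * A * γ ^ (n + 1 - k) + S ^ 2 * B * γ ^ (n + 1) := by
        intro k hk
        rw [Finset.mem_Icc] at hk
        have := hZ.covariance_le h hV hV1 hR hγ0 hs hS hsS k (n + 1 - k)
        rw [show k + (n + 1 - k) = n + 1 by omega] at this
        linarith
      refine (Finset.sum_le_sum hterm).trans ?_
      rw [Finset.sum_add_distrib, ← Finset.mul_sum]
      have hrefl : ∑ k ∈ Finset.Icc 1 n, γ ^ (n + 1 - k) = ∑ k ∈ Finset.Icc 1 n, γ ^ k := by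
        refine Finset.sum_nbij' (fun k => n + 1 - k) (fun k => n + 1 - k) ?_ ?_ ?_ ?_ ?_ <;>
        · intro k hk
          simp only [Finset.mem_Icc] at hk ⊢
          try omega
      rw [hrefl]
      simp only [Finset.sum_const, Nat.card_Icc, Nat.add_sub_cancel, nsmul_eq_mul]
      have h1 := mul_le_mul_of_nonneg_left (sum_geometric_Icc_le hγ0 hγ n)
        (by positivity : 0 ≤ S * R * A)
      -- The n nonstationary errors all carry the same factor γ^(n+1), since k + i = n + 1; their
      -- total is absorbed by the next term of the convergent series ∑ k γ^k.
      have h2 : (n : ℝ) * (S ^ 2 * B * γ ^ (n + 1)) ≤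
          S ^ 2 * B * (((n + 1 : ℕ) : ℝ) * γ ^ (n + 1)) := by
        have : 0 ≤ S ^ 2 * B * γ ^ (n + 1) := by positivity
        push_cast
        linarith
      linarith
    have hvar := hZ.variance_le h hV1 hs hsS (n + 1)
    have e : 2 * R / (1 - γ) = 2 * (R * (1 / (1 - γ))) := by ring
    rw [e] at ih ⊢
    push_cast at hcov ⊢
    linarith

theorem IsMarkovChain.variance_mean_le (hZ : IsMarkovChain P K x₀ Z)
    (h : GeometricErgodicity K π V R γ) (hV : Measurable V)
    (hV1 : ∀ x, 1 ≤ V x) (hR : 0 ≤ R) (hγ0 : 0 ≤ γ) (hγ : γ < 1) (hs : Measurable s) (hS : 0 ≤ S)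
    (hsS : ∀ z, |s z| ≤ S) {n : ℕ} (hn : 1 ≤ n) :
    Var[fun ω => (1 / n : ℝ) * ∑ k ∈ Finset.Icc 1 n, s (Z k ω); P] ≤
      1 / n * ∫ z, s z ^ 2 ∂π + S / n * (2 * R / (1 - γ) * ∫ z, |s z| * V z ∂π) +
        (R * V x₀ * (1 / (1 - γ)) + 2 * (R * V x₀ * (R + 1)) * ∑' k : ℕ, (k : ℝ) * γ ^ k) *
          S ^ 2 / n ^ 2 := by
  have hn0 : (0 : ℝ) < n := by exact_mod_cast hn
  have hV0 : 0 ≤ V x₀ := zero_le_one.trans (hV1 x₀)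
  have h1 := hZ.variance_sum_le h hV hV1 hR hγ0 hγ hs hS hsS n
  have h2 := sum_geometric_Icc_le hγ0 hγ n
  have h3 : ∑ k ∈ Finset.Icc 1 n, (k : ℝ) * γ ^ k ≤ ∑' k : ℕ, (k : ℝ) * γ ^ k := by
    have hs := summable_pow_mul_geometric_of_norm_lt_one 1
      (show ‖γ‖ < 1 by rwa [Real.norm_eq_abs, abs_of_nonneg hγ0])
    simp only [pow_one] at hs
    exact hs.sum_le_tsum _ fun k _ => by positivity
  have h4 : R * V x₀ * ∑ k ∈ Finset.Icc 1 n, γ ^ k +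
      2 * (R * V x₀ * (R + 1)) * ∑ k ∈ Finset.Icc 1 n, k * γ ^ k ≤
      R * V x₀ * (1 / (1 - γ)) + 2 * (R * V x₀ * (R + 1)) * ∑' k : ℕ, (k : ℝ) * γ ^ k := by
    gcongr
  have h5 := h1.trans (add_le_add_right (mul_le_mul_of_nonneg_left h4 (sq_nonneg S)) _)
  rw [variance_const_mul]
  refine (mul_le_mul_of_nonneg_left h5 (sq_nonneg _)).trans (le_of_eq ?_)
  field_simp

end Chain

/-! ### The hazard along a path, in the coordinate of the post-jump location. -/

section Path

open Filter Topology

variable {φ : ℝ≥0 → ℝ≥0 → ℝ≥0} {f : ℝ≥0 ≃o ℝ≥0} {κ : ℝ} {m M : ℝ≥0 → ℝ}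

theorem IsFlow.continuous_uncurry (h : IsFlow φ) : Continuous (Function.uncurry φ) := by
  have h1 : ContinuousOn (fun p : ℝ × ℝ => (φ p.1.toNNReal p.2.toNNReal : ℝ)) (Ici 0 ×ˢ Ici 0) :=
    h.contDiff.continuousOn
  have h2 : Continuous fun p : ℝ≥0 × ℝ≥0 => ((p.1 : ℝ), (p.2 : ℝ)) := by fun_prop
  have h3 := h1.comp_continuous h2 fun p => ⟨p.1.2, p.2.2⟩
  rw [NNReal.isEmbedding_coe.continuous_iff]
  refine h3.congr fun p => ?_
  simp [Function.uncurry]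

/-- The post-jump location, as a function of the jump time. -/
def jumpLocation (φ : ℝ≥0 → ℝ≥0 → ℝ≥0) (f : ℝ≥0 ≃o ℝ≥0) (x t : ℝ≥0) : ℝ≥0 := f (φ x t)

/-- The jump time that leads to the post-jump location `u`. -/
noncomputable def jumpTime (φ : ℝ≥0 → ℝ≥0 → ℝ≥0) (f : ℝ≥0 ≃o ℝ≥0) (x : ℝ≥0) (u : ℝ) : ℝ :=
  ((Function.invFun (fun t : ℝ≥0 => f (φ x t)) u.toNNReal : ℝ≥0) : ℝ)

/-- The cumulated jump rate, as a function of a real time. -/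
noncomputable def hazard (φ : ℝ≥0 → ℝ≥0 → ℝ≥0) (rate : ℝ≥0 → ℝ≥0) (x : ℝ≥0) (t : ℝ) : ℝ :=
  ∫ s in (0 : ℝ)..t, (rate (φ x s.toNNReal) : ℝ)

/-- The cumulated jump rate, as a function of the post-jump location. -/
noncomputable def hazardAt (φ : ℝ≥0 → ℝ≥0 → ℝ≥0) (f : ℝ≥0 ≃o ℝ≥0) (rate : ℝ≥0 → ℝ≥0) (x : ℝ≥0)
    (u : ℝ) : ℝ :=
  hazard φ rate x (jumpTime φ f x u)

theorem IsFlow.continuous_path (h : IsFlow φ) (x : ℝ≥0) : Continuous (φ x) :=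
  h.continuous_uncurry.comp (Continuous.prodMk_right x)

theorem IsFlow.strictMono_jumpLocation (h : IsFlow φ) (f : ℝ≥0 ≃o ℝ≥0) (x : ℝ≥0) :
    StrictMono (jumpLocation φ f x) :=
  f.strictMono.comp (h.strictMono x)

theorem IsFlow.jumpLocation_zero (h : IsFlow φ) (f : ℝ≥0 ≃o ℝ≥0) (x : ℝ≥0) :
    jumpLocation φ f x 0 = f x := by
  rw [jumpLocation, h.zero]

theorem IsFlow.range_jumpLocation (h : IsFlow φ) (f : ℝ≥0 ≃o ℝ≥0) (x : ℝ≥0) :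
    range (jumpLocation φ f x) = Ici (f x) := by
  have : jumpLocation φ f x = f ∘ φ x := rfl
  rw [this, range_comp, h.range_eq, OrderIso.image_Ici]

theorem IsFlow.jumpTime_jumpLocation (h : IsFlow φ) (f : ℝ≥0 ≃o ℝ≥0) (x t : ℝ≥0) :
    jumpTime φ f x (jumpLocation φ f x t) = t := by
  rw [jumpTime, Real.toNNReal_coe]
  exact congrArg _ (Function.leftInverse_invFun (h.strictMono_jumpLocation f x).injective t)

theorem IsFlow.jumpLocation_jumpTime (h : IsFlow φ) (f : ℝ≥0 ≃o ℝ≥0) (x : ℝ≥0) {u : ℝ}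
    (hu : (f x : ℝ) ≤ u) : jumpLocation φ f x (jumpTime φ f x u).toNNReal = u.toNNReal := by
  have hmem : u.toNNReal ∈ range (jumpLocation φ f x) := by
    rw [h.range_jumpLocation]
    exact NNReal.le_toNNReal_of_coe_le hu
  rw [jumpTime, Real.toNNReal_coe]
  exact Function.invFun_eq hmem

theorem jumpTime_nonneg (φ : ℝ≥0 → ℝ≥0 → ℝ≥0) (f : ℝ≥0 ≃o ℝ≥0) (x : ℝ≥0) (u : ℝ) :
    0 ≤ jumpTime φ f x u := NNReal.coe_nonneg _

theorem IsFlow.path_jumpTime (h : IsFlow φ) (f : ℝ≥0 ≃o ℝ≥0) (x : ℝ≥0) {u : ℝ}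
    (hu : (f x : ℝ) ≤ u) : φ x (jumpTime φ f x u).toNNReal = f.symm u.toNNReal := by
  rw [← h.jumpLocation_jumpTime f x hu, jumpLocation, OrderIso.symm_apply_apply]

theorem IsFlow.jumpTime_map (h : IsFlow φ) (f : ℝ≥0 ≃o ℝ≥0) (x : ℝ≥0) :
    jumpTime φ f x (f x) = 0 := by
  rw [← h.jumpLocation_zero f x, h.jumpTime_jumpLocation, NNReal.coe_zero]

theorem IsFlow.strictMonoOn_jumpTime (h : IsFlow φ) (f : ℝ≥0 ≃o ℝ≥0) (x : ℝ≥0) :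
    StrictMonoOn (jumpTime φ f x) (Ici (f x : ℝ)) := by
  intro u hu v hv huv
  have h1 := h.jumpLocation_jumpTime f x hu
  have h2 := h.jumpLocation_jumpTime f x hv
  have h3 : u.toNNReal < v.toNNReal :=
    (Real.toNNReal_lt_toNNReal_iff ((f x).2.trans_lt (lt_of_le_of_lt hu huv))).2 huv
  rw [← h1, ← h2, (h.strictMono_jumpLocation f x).lt_iff_lt] at h3
  exact (Real.toNNReal_lt_toNNReal_iff_of_nonneg (jumpTime_nonneg φ f x u)).1 h3

theorem IsFlow.image_jumpTime_Ici (h : IsFlow φ) (f : ℝ≥0 ≃o ℝ≥0) (x : ℝ≥0) :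
    jumpTime φ f x '' Ici (f x : ℝ) = Ici 0 := by
  refine Subset.antisymm (image_subset_iff.2 fun u _ => jumpTime_nonneg φ f x u) fun t ht => ?_
  refine ⟨jumpLocation φ f x t.toNNReal, ?_, ?_⟩
  · have : jumpLocation φ f x t.toNNReal ∈ Ici (f x) := by
      rw [← h.range_jumpLocation]; exact mem_range_self _
    exact_mod_cast this
  · rw [h.jumpTime_jumpLocation, Real.coe_toNNReal _ ht]

theorem IsFlow.image_jumpTime_Ioi (h : IsFlow φ) (f : ℝ≥0 ≃o ℝ≥0) (x : ℝ≥0) :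
    jumpTime φ f x '' Ioi (f x : ℝ) = Ioi 0 := by
  rw [← Ici_sdiff_left, (h.strictMonoOn_jumpTime f x).injOn.image_sdiff, h.image_jumpTime_Ici]
  have : Ici (f x : ℝ) ∩ {(f x : ℝ)} = {(f x : ℝ)} := by
    rw [inter_eq_right, singleton_subset_iff]; exact self_mem_Ici
  rw [this, image_singleton, h.jumpTime_map, Ici_sdiff_left]

theorem IsFlow.continuousOn_jumpTime (h : IsFlow φ) (f : ℝ≥0 ≃o ℝ≥0) (x : ℝ≥0) :
    ContinuousOn (jumpTime φ f x) (Ici (f x : ℝ)) := by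
  intro u hu
  rcases eq_or_lt_of_le (show (f x : ℝ) ≤ u from hu) with rfl | hlt
  · refine (h.strictMonoOn_jumpTime f x).continuousWithinAt_right_of_surjOn (s := Ici (f x : ℝ))
      self_mem_nhdsWithin ?_
    intro t ht
    rw [h.jumpTime_map] at ht
    rw [h.image_jumpTime_Ici]
    exact (mem_Ioi.1 ht).le
  · refine ContinuousAt.continuousWithinAt ?_
    refine (h.strictMonoOn_jumpTime f x).continuousAt_of_image_mem_nhds (Ici_mem_nhds hlt) ?_
    rw [h.image_jumpTime_Ici]
    refine Ici_mem_nhds ?_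
    rw [← h.jumpTime_map f x]
    exact h.strictMonoOn_jumpTime f x self_mem_Ici hu hlt

/-- The lower bound by m > 0 contains differentiability: `derivWithin` has the default value 0 where
no derivative exists, so a nonzero value certifies one. -/
theorem Assumptions.hasDerivAt_jumpTime (hyp : Assumptions φ f κ m M) (x : ℝ≥0) {u : ℝ}
    (hu : (f x : ℝ) < u) :
    HasDerivAt (jumpTime φ f x) (invDeriv φ f x u.toNNReal) u := by
  have hu0 : 0 < u := (f x).2.trans_lt hu
  have h1 := (hyp.invDeriv_mem x u.toNNReal (Real.toNNReal_pos.2 hu0)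
    (NNReal.le_toNNReal_of_coe_le hu.le)).1
  have h2 : invDeriv φ f x u.toNNReal = derivWithin (jumpTime φ f x) (Ici (f x : ℝ)) u := by
    rw [invDeriv, Real.coe_toNNReal _ hu0.le]
    rfl
  have h3 : derivWithin (jumpTime φ f x) (Ici (f x : ℝ)) u ≠ 0 := by
    rw [← h2]; exact ((hyp.m_pos _).trans_le h1).ne'
  rw [h2]
  exact (differentiableWithinAt_of_derivWithin_ne_zero h3).hasDerivWithinAt.hasDerivAt
    (Ici_mem_nhds hu)

variable {rate : ℝ≥0 → ℝ≥0}

theorem IsFlow.continuous_rate_path (h : IsFlow φ) (hrate : Continuous rate) (x : ℝ≥0) :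
    Continuous fun s : ℝ => (rate (φ x s.toNNReal) : ℝ) :=
  NNReal.continuous_coe.comp (hrate.comp ((h.continuous_path x).comp continuous_real_toNNReal))

theorem IsFlow.hasDerivAt_hazard (h : IsFlow φ) (hrate : Continuous rate) (x : ℝ≥0) (t : ℝ) :
    HasDerivAt (hazard φ rate x) (rate (φ x t.toNNReal)) t :=
  intervalIntegral.integral_hasDerivAt_right
    ((h.continuous_rate_path hrate x).intervalIntegrable _ _)
    ((h.continuous_rate_path hrate x).stronglyMeasurableAtFilter _ _)
    (h.continuous_rate_path hrate x).continuousAt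

theorem IsFlow.continuous_hazard (h : IsFlow φ) (hrate : Continuous rate) (x : ℝ≥0) :
    Continuous (hazard φ rate x) :=
  continuous_iff_continuousAt.2 fun t => (h.hasDerivAt_hazard hrate x t).continuousAt

theorem IsFlow.monotone_hazard (h : IsFlow φ) (hrate : Continuous rate) (x : ℝ≥0) :
    Monotone (hazard φ rate x) :=
  monotone_of_deriv_nonneg (fun t => (h.hasDerivAt_hazard hrate x t).differentiableAt) fun t => by
    rw [(h.hasDerivAt_hazard hrate x t).deriv]; exact NNReal.coe_nonneg _

theorem hazard_zero (φ : ℝ≥0 → ℝ≥0 → ℝ≥0) (rate : ℝ≥0 → ℝ≥0) (x : ℝ≥0) :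
    hazard φ rate x 0 = 0 := by simp [hazard]

theorem IsFlow.hazard_nonneg (h : IsFlow φ) (hrate : Continuous rate) (x : ℝ≥0) {t : ℝ}
    (ht : 0 ≤ t) : 0 ≤ hazard φ rate x t := by
  rw [← hazard_zero φ rate x]; exact h.monotone_hazard hrate x ht

theorem IsFlow.continuousOn_hazardAt (h : IsFlow φ) (f : ℝ≥0 ≃o ℝ≥0) (hrate : Continuous rate)
    (x : ℝ≥0) : ContinuousOn (hazardAt φ f rate x) (Ici (f x : ℝ)) :=
  (h.continuous_hazard hrate x).comp_continuousOn (h.continuousOn_jumpTime f x)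

theorem IsFlow.hazardAt_nonneg (h : IsFlow φ) (f : ℝ≥0 ≃o ℝ≥0) (hrate : Continuous rate)
    (x : ℝ≥0) (u : ℝ) : 0 ≤ hazardAt φ f rate x u :=
  h.hazard_nonneg hrate x (jumpTime_nonneg φ f x u)

theorem IsFlow.hazardAt_jumpLocation (h : IsFlow φ) (f : ℝ≥0 ≃o ℝ≥0) (rate : ℝ≥0 → ℝ≥0)
    (x t : ℝ≥0) : hazardAt φ f rate x (jumpLocation φ f x t) = hazard φ rate x t := by
  rw [hazardAt, h.jumpTime_jumpLocation]

/-- Chain rule; a jump to u starts from f⁻¹(u) whatever x is, so x enters only through g_x. -/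
theorem Assumptions.hasDerivAt_hazardAt (hyp : Assumptions φ f κ m M) (hrate : Continuous rate)
    (x : ℝ≥0) {u : ℝ} (hu : (f x : ℝ) < u) :
    HasDerivAt (hazardAt φ f rate x)
      (rate (f.symm u.toNNReal) * invDeriv φ f x u.toNNReal) u := by
  have h := (hyp.isFlow.hasDerivAt_hazard hrate x (jumpTime φ f x u)).comp u
    (hyp.hasDerivAt_jumpTime x hu)
  rwa [hyp.isFlow.path_jumpTime f x hu.le] at h

theorem Assumptions.invDeriv_bounds (hyp : Assumptions φ f κ m M) (x : ℝ≥0) {u : ℝ}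
    (hu : (f x : ℝ) < u) :
    m u.toNNReal ≤ invDeriv φ f x u.toNNReal ∧ invDeriv φ f x u.toNNReal ≤ M u.toNNReal :=
  hyp.invDeriv_mem x _ (Real.toNNReal_pos.2 ((f x).2.trans_lt hu))
    (NNReal.le_toNNReal_of_coe_le hu.le)

variable {r : ℝ≥0} {L a b : ℝ}

theorem Assumptions.rate_lower_bound (hyp : Assumptions φ f κ m M) (ha : 0 < a)
    (hrate : rate ∈ rateClass f m M r L a b) {u : ℝ} (hu : (f r : ℝ) ≤ u) :
    a * u ^ b ≤ rate (f.symm u.toNNReal) * m u.toNNReal := by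
  have hu0 : 0 ≤ u := (f r).2.trans hu
  have h := hrate.2.1 (f.symm u.toNNReal) ((OrderIso.le_symm_apply f).2
    (NNReal.le_toNNReal_of_coe_le hu))
  rw [OrderIso.apply_symm_apply, Real.coe_toNNReal _ hu0,
    div_le_div_iff₀ (hyp.m_pos _) ha] at h
  linarith

/-- Beyond q ≥ f(r) the hazard grows at rate at least λ(f⁻¹(v)) m(v) ≥ a v^b, so subtracting the
primitive of a v^b leaves a monotone function. The condition q ≥ f(x) keeps the comparison on the
reachable locations. -/
theorem Assumptions.rpow_sub_le_hazardAt (hyp : Assumptions φ f κ m M) (ha : 0 < a) (hb : 0 < b)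
    (hrate : rate ∈ rateClass f m M r L a b) (x : ℝ≥0) {q u : ℝ} (hqx : (f x : ℝ) ≤ q)
    (hqr : (f r : ℝ) ≤ q) (hu : q ≤ u) :
    a / (b + 1) * (u ^ (b + 1) - q ^ (b + 1)) ≤ hazardAt φ f rate x u := by
  have hb1 : 0 < b + 1 := by linarith
  have hq0 : 0 ≤ q := (f x).2.trans hqx
  have hd : ∀ v ∈ interior (Ici q), HasDerivAt
      (fun v => hazardAt φ f rate x v - a / (b + 1) * v ^ (b + 1))
      (rate (f.symm v.toNNReal) * invDeriv φ f x v.toNNReal - a * v ^ b) v := by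
    intro v hv
    rw [interior_Ici] at hv
    have h1 := hyp.hasDerivAt_hazardAt hrate.1 x (lt_of_le_of_lt hqx hv)
    have h2 := (Real.hasDerivAt_rpow_const (x := v) (p := b + 1)
      (Or.inr (by linarith))).const_mul (a / (b + 1))
    refine (h1.sub h2).congr_deriv ?_
    rw [add_sub_cancel_right]
    field_simp
  have hmono : MonotoneOn (fun v => hazardAt φ f rate x v - a / (b + 1) * v ^ (b + 1)) (Ici q) := by
    refine monotoneOn_of_deriv_nonneg (convex_Ici q) ?_ (fun v hv =>
      (hd v hv).differentiableAt.differentiableWithinAt) fun v hv => ?_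
    · refine ((hyp.isFlow.continuousOn_hazardAt f hrate.1 x).mono (Ici_subset_Ici.2 hqx)).sub ?_
      exact (continuous_const.mul (Real.continuous_rpow_const hb1.le)).continuousOn
    · rw [(hd v hv).deriv]
      rw [interior_Ici] at hv
      have h1 := hyp.rate_lower_bound ha hrate (hqr.trans (le_of_lt hv))
      have h2 := mul_le_mul_of_nonneg_left (hyp.invDeriv_bounds x (lt_of_le_of_lt hqx hv)).1
        (rate (f.symm v.toNNReal)).2
      exact sub_nonneg.2 (h1.trans h2)
  have := hmono self_mem_Ici hu hu
  have h0 := hyp.isFlow.hazardAt_nonneg f hrate.1 x q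
  simp only at this
  linarith

theorem Assumptions.continuous_weighted_rate (hyp : Assumptions φ f κ m M)
    (hrate : Continuous rate) :
    Continuous fun u : ℝ => M u.toNNReal * (rate (f.symm u.toNNReal) : ℝ) :=
  (hyp.continuous_M.comp continuous_real_toNNReal).mul (NNReal.continuous_coe.comp
    (hrate.comp (f.symm.continuous.comp continuous_real_toNNReal)))

/-- The integral starts at 0 rather than at f(x), so the bound is the same for all x and its part up
to f(r) is at most L in the class. -/
theorem Assumptions.hazardAt_le (hyp : Assumptions φ f κ m M)
    (hrate : Continuous rate) (x : ℝ≥0) {u : ℝ} (hu : (f x : ℝ) ≤ u) :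
    hazardAt φ f rate x u ≤ ∫ v in (0 : ℝ)..u, M v.toNNReal * (rate (f.symm v.toNNReal) : ℝ) := by
  have hc := hyp.continuous_weighted_rate hrate
  have hI : ∀ v, HasDerivAt
      (fun v => ∫ v in (0 : ℝ)..v, M v.toNNReal * (rate (f.symm v.toNNReal) : ℝ))
      (M v.toNNReal * (rate (f.symm v.toNNReal) : ℝ)) v := fun v =>
    intervalIntegral.integral_hasDerivAt_right (hc.intervalIntegrable _ _)
      (hc.stronglyMeasurableAtFilter _ _) hc.continuousAt
  have hd : ∀ v ∈ interior (Ici (f x : ℝ)), HasDerivAt (fun v =>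
      (∫ v in (0 : ℝ)..v, M v.toNNReal * (rate (f.symm v.toNNReal) : ℝ)) - hazardAt φ f rate x v)
      (M v.toNNReal * (rate (f.symm v.toNNReal) : ℝ) -
        rate (f.symm v.toNNReal) * invDeriv φ f x v.toNNReal) v := fun v hv => by
    rw [interior_Ici] at hv
    exact (hI v).sub (hyp.hasDerivAt_hazardAt hrate x hv)
  have hmono : MonotoneOn (fun v =>
      (∫ v in (0 : ℝ)..v, M v.toNNReal * (rate (f.symm v.toNNReal) : ℝ)) - hazardAt φ f rate x v)
      (Ici (f x : ℝ)) := by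
    refine monotoneOn_of_deriv_nonneg (convex_Ici _) ?_ (fun v hv =>
      (hd v hv).differentiableAt.differentiableWithinAt) fun v hv => ?_
    · exact (continuous_iff_continuousAt.2 fun v => (hI v).continuousAt).continuousOn.sub
        (hyp.isFlow.continuousOn_hazardAt f hrate x)
    · rw [(hd v hv).deriv]
      rw [interior_Ici] at hv
      have h2 := mul_le_mul_of_nonneg_left (hyp.invDeriv_bounds x hv).2
        (rate (f.symm v.toNNReal)).2
      change _ ≤ (rate (f.symm v.toNNReal) : ℝ) * _ at h2
      rw [mul_comm (M _)]
      exact sub_nonneg.2 h2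
  have := hmono self_mem_Ici hu hu
  have h0 : hazardAt φ f rate x (f x) = 0 := by
    rw [hazardAt, hyp.isFlow.jumpTime_map, hazard_zero]
  have h1 : 0 ≤ ∫ v in (0 : ℝ)..(f x), M v.toNNReal * (rate (f.symm v.toNNReal) : ℝ) :=
    intervalIntegral.integral_nonneg (f x).2 fun v _ =>
      mul_nonneg ((hyp.m_pos _).le.trans (hyp.m_le_M _)) (NNReal.coe_nonneg _)
  simp only [h0] at this
  linarith

theorem Assumptions.tendsto_hazard (hyp : Assumptions φ f κ m M) (ha : 0 < a) (hb : 0 < b)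
    (hrate : rate ∈ rateClass f m M r L a b) (x : ℝ≥0) :
    Tendsto (hazard φ rate x) atTop atTop := by
  have hb1 : 0 < b + 1 := by linarith
  refine tendsto_atTop_atTop_of_monotone (hyp.isFlow.monotone_hazard hrate.1 x) fun B => ?_
  set q : ℝ := max (f x) (f r)
  have hlim : Tendsto (fun u : ℝ => a / (b + 1) * (u ^ (b + 1) - q ^ (b + 1))) atTop atTop :=
    ((tendsto_rpow_atTop hb1).atTop_add tendsto_const_nhds).const_mul_atTop (by positivity)
  obtain ⟨u, hBu, hqu⟩ := ((hlim.eventually_ge_atTop B).and (eventually_ge_atTop q)).exists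
  exact ⟨jumpTime φ f x u, hBu.trans
    (hyp.rpow_sub_le_hazardAt ha hb hrate x (le_max_left _ _) (le_max_right _ _) hqu)⟩

/-- The integrand is the derivative of -exp(-cΛ)/c, and Λ tends to infinity. With c = 1 this gives
total mass and tails of the jump time; with c = 1 - θ it gives the exponential moment of order θ of
Λ. -/
theorem Assumptions.lintegral_exp_hazard (hyp : Assumptions φ f κ m M) (ha : 0 < a) (hb : 0 < b)
    (hrate : rate ∈ rateClass f m M r L a b) (x : ℝ≥0) {c : ℝ} (hc : 0 < c) (τ : ℝ) :
    ∫⁻ t in Ioi τ, ENNReal.ofReal (rate (φ x t.toNNReal) * Real.exp (-(c * hazard φ rate x t))) =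
      ENNReal.ofReal (Real.exp (-(c * hazard φ rate x τ)) / c) := by
  have hd : ∀ t ∈ Ici τ, HasDerivAt (fun t => -(Real.exp (-(c * hazard φ rate x t)) / c))
      (rate (φ x t.toNNReal) * Real.exp (-(c * hazard φ rate x t))) t := fun t _ => by
    have h := (((hyp.isFlow.hasDerivAt_hazard hrate.1 x t).const_mul c).neg.exp.div_const c).neg
    refine h.congr_deriv ?_
    simp only [Pi.neg_apply]
    field_simp
  have h0 : ∀ t ∈ Ioi τ, 0 ≤ rate (φ x t.toNNReal) * Real.exp (-(c * hazard φ rate x t)) :=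
    fun t _ => mul_nonneg (NNReal.coe_nonneg _) (Real.exp_pos _).le
  have hlim : Tendsto (fun t => -(Real.exp (-(c * hazard φ rate x t)) / c)) atTop (𝓝 0) := by
    have h1 := Real.tendsto_exp_neg_atTop_nhds_zero.comp
      ((hyp.tendsto_hazard ha hb hrate x).const_mul_atTop hc)
    simpa using (h1.div_const c).neg
  have hint := integrableOn_Ioi_deriv_of_nonneg' hd h0 hlim
  rw [← ofReal_integral_eq_lintegral_ofReal hint
    ((ae_restrict_iff' measurableSet_Ioi).2 (ae_of_all _ h0)),
    integral_Ioi_of_hasDerivAt_of_nonneg' hd h0 hlim]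
  simp

end Path

/-! ### Drift and minorization for the jump kernel, uniformly over the class of rates. -/

section JumpKernel

open Filter Topology

variable {φ : ℝ≥0 → ℝ≥0 → ℝ≥0} {f : ℝ≥0 ≃o ℝ≥0} {κ : ℝ} {m M : ℝ≥0 → ℝ} {rate : ℝ≥0 → ℝ≥0}
  {r : ℝ≥0} {L a b : ℝ}

theorem lintegral_halfLine {F : ℝ≥0 → ℝ≥0∞} (hF : Measurable F) :
    ∫⁻ t, F t ∂halfLine = ∫⁻ t in Ioi (0 : ℝ), F t.toNNReal := by
  rw [halfLine, lintegral_map hF measurable_real_toNNReal, restrict_Ioi_eq_restrict_Ici]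

instance : SigmaFinite halfLine := by
  refine SigmaFinite.of_map halfLine (f := ((↑) : ℝ≥0 → ℝ)) measurable_coe_nnreal_real.aemeasurable ?_
  have : halfLine.map ((↑) : ℝ≥0 → ℝ) = (volume : Measure ℝ).restrict (Ici 0) := by
    rw [halfLine, Measure.map_map measurable_coe_nnreal_real measurable_real_toNNReal]
    conv_rhs => rw [← Measure.map_id (μ := (volume : Measure ℝ).restrict (Ici 0))]
    refine Measure.map_congr ((ae_restrict_iff' measurableSet_Ici).2 (ae_of_all _ fun t ht => ?_))
    exact Real.coe_toNNReal t ht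
  rw [this]
  infer_instance

theorem IsFlow.measurable_jumpLocation (h : IsFlow φ) (f : ℝ≥0 ≃o ℝ≥0) (x : ℝ≥0) :
    Measurable (jumpLocation φ f x) :=
  (f.continuous.comp (h.continuous_path x)).measurable

theorem IsFlow.lintegral_jumpKernel (h : IsFlow φ) (f : ℝ≥0 ≃o ℝ≥0) (hrate : Continuous rate)
    (x : ℝ≥0) {F : ℝ≥0 → ℝ≥0∞} (hF : Measurable F) :
    ∫⁻ z, F z ∂(jumpKernel φ f rate x) = ∫⁻ t in Ioi (0 : ℝ),
      ENNReal.ofReal (rate (φ x t.toNNReal) * Real.exp (-hazard φ rate x t)) *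
        F (jumpLocation φ f x t.toNNReal) := by
  have hloc := h.measurable_jumpLocation f x
  have hFloc : Measurable fun t => F (jumpLocation φ f x t) := hF.comp hloc
  have hdens : Measurable fun t : ℝ≥0 => (jumpTimeDensity φ rate x t : ℝ≥0∞) := by
    have h1 : Continuous fun t : ℝ≥0 => cumRate φ rate x t :=
      (h.continuous_hazard hrate x).comp NNReal.continuous_coe
    have h2 : Continuous fun t : ℝ≥0 => jumpTimeDensity φ rate x t := by
      unfold jumpTimeDensity
      exact (hrate.comp (h.continuous_path x)).mul (by fun_prop)
    exact (ENNReal.continuous_coe.comp h2).measurable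
  rw [jumpKernel_apply f h.continuous_uncurry hrate]
  change ∫⁻ z, F z ∂(Measure.map (jumpLocation φ f x) _) = _
  rw [lintegral_map hF hloc,
    lintegral_withDensity_eq_lintegral_mul _ hdens hFloc, lintegral_halfLine (hdens.mul hFloc)]
  refine setLIntegral_congr_fun measurableSet_Ioi fun t ht => ?_
  have ht0 : 0 ≤ t := (mem_Ioi.1 ht).le
  simp only [Pi.mul_apply, jumpTimeDensity, cumRate, ENNReal.coe_mul,
    Real.coe_toNNReal t ht0]
  rw [ENNReal.ofReal_mul (NNReal.coe_nonneg _), ENNReal.ofReal_coe_nnreal]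
  rfl

theorem Assumptions.isMarkovKernel_jumpKernel (hyp : Assumptions φ f κ m M) (ha : 0 < a)
    (hb : 0 < b) (hrate : rate ∈ rateClass f m M r L a b) :
    IsMarkovKernel (jumpKernel φ f rate) := by
  refine ⟨fun x => ⟨?_⟩⟩
  have h := hyp.isFlow.lintegral_jumpKernel f hrate.1 x (F := fun _ => 1) measurable_const
  rw [lintegral_one] at h
  rw [h]
  have h2 := hyp.lintegral_exp_hazard ha hb hrate x one_pos 0
  simp only [one_mul, hazard_zero, mul_one] at h2 ⊢
  rw [h2]
  simp

theorem Assumptions.rpow_map_le (hyp : Assumptions φ f κ m M) {p : ℝ} (hp : 0 < p) (z : ℝ≥0) :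
    (f z : ℝ) ^ p ≤ κ ^ p * (z : ℝ) ^ p := by
  rw [← Real.mul_rpow hyp.kappa_pos.le z.coe_nonneg]
  refine Real.rpow_le_rpow (f z).2 ?_ hp.le
  rcases eq_zero_or_pos z with rfl | hz
  · have : f 0 = 0 := f.map_bot
    simp [this]
  · exact (hyp.map_le z hz).2

/-- The exponential moment bound behind the drift condition. -/
theorem Assumptions.lintegral_V_le (hyp : Assumptions φ f κ m M) (ha : 0 < a) (hb : 0 < b)
    (hrate : rate ∈ rateClass f m M r L a b) (x : ℝ≥0) {q : ℝ} (hqx : (f x : ℝ) ≤ q)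
    (hqr : (f r : ℝ) ≤ q) :
    ∫⁻ z, ENNReal.ofReal (V f a b z) ∂(jumpKernel φ f rate x) ≤
      ENNReal.ofReal (Real.exp (a / (b + 1) * κ ^ (b + 1) * q ^ (b + 1)) / (1 - κ ^ (b + 1))) := by
  have hb1 : 0 < b + 1 := by linarith
  set α := a / (b + 1) with hα
  have hα0 : 0 < α := by positivity
  set θ := κ ^ (b + 1) with hθ
  have hθ0 : 0 < θ := Real.rpow_pos_of_pos hyp.kappa_pos _
  have hθ1 : θ < 1 := Real.rpow_lt_one hyp.kappa_pos.le hyp.kappa_lt_one hb1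
  have hVm : Measurable fun z => ENNReal.ofReal (V f a b z) := by
    unfold V
    have : Continuous f := f.continuous
    fun_prop
  rw [hyp.isFlow.lintegral_jumpKernel f hrate.1 x hVm]
  -- `V` applies f once more to the new location, which produces the factor θ < 1; the hazard thus
  -- enters with exponent θ, within reach of the exponential law.
  have hV : ∀ t : ℝ≥0, V f a b (jumpLocation φ f x t) ≤
      Real.exp (α * θ * q ^ (b + 1)) * Real.exp (θ * hazard φ rate x t) := by
    intro t
    set z := jumpLocation φ f x t with hz
    have h1 : α * (z : ℝ) ^ (b + 1) ≤ α * q ^ (b + 1) + hazard φ rate x t := by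
      have h0 := hyp.isFlow.hazard_nonneg hrate.1 x t.2
      rcases le_total (z : ℝ) q with hzq | hzq
      · have : (z : ℝ) ^ (b + 1) ≤ q ^ (b + 1) := Real.rpow_le_rpow z.2 hzq hb1.le
        have := mul_le_mul_of_nonneg_left this hα0.le
        linarith! only [this, h0]
      · have := hyp.rpow_sub_le_hazardAt ha hb hrate x hqx hqr hzq
        rw [hz, hyp.isFlow.hazardAt_jumpLocation, ← hz, ← hα] at this
        linarith
    rw [V, ← Real.exp_add]
    refine Real.exp_le_exp.2 ?_
    calc α * (f z : ℝ) ^ (b + 1) ≤ α * (θ * (z : ℝ) ^ (b + 1)) :=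
          mul_le_mul_of_nonneg_left (hyp.rpow_map_le hb1 z) hα0.le
      _ = θ * (α * (z : ℝ) ^ (b + 1)) := by ring
      _ ≤ θ * (α * q ^ (b + 1) + hazard φ rate x t) := mul_le_mul_of_nonneg_left h1 hθ0.le
      _ = _ := by ring
  have h2 := hyp.lintegral_exp_hazard ha hb hrate x (sub_pos.2 hθ1) 0
  rw [hazard_zero, mul_zero, neg_zero, Real.exp_zero] at h2
  calc ∫⁻ t in Ioi (0 : ℝ), ENNReal.ofReal (rate (φ x t.toNNReal) * Real.exp (-hazard φ rate x t)) *
        ENNReal.ofReal (V f a b (jumpLocation φ f x t.toNNReal))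
      ≤ ∫⁻ t in Ioi (0 : ℝ), ENNReal.ofReal (Real.exp (α * θ * q ^ (b + 1))) *
          ENNReal.ofReal (rate (φ x t.toNNReal) * Real.exp (-((1 - θ) * hazard φ rate x t))) := by
        refine setLIntegral_mono' measurableSet_Ioi fun t ht => ?_
        have ht0 : 0 ≤ t := (mem_Ioi.1 ht).le
        have h3 := hV t.toNNReal
        rw [Real.coe_toNNReal t ht0] at h3
        rw [← ENNReal.ofReal_mul (by positivity), ← ENNReal.ofReal_mul (by positivity)]
        refine ENNReal.ofReal_le_ofReal ?_
        calc _ ≤ rate (φ x t.toNNReal) * Real.exp (-hazard φ rate x t) *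
              (Real.exp (α * θ * q ^ (b + 1)) * Real.exp (θ * hazard φ rate x t)) := by gcongr
          _ = Real.exp (α * θ * q ^ (b + 1)) * (rate (φ x t.toNNReal) *
              (Real.exp (-hazard φ rate x t) * Real.exp (θ * hazard φ rate x t))) := by ring
          _ = _ := by
              rw [← Real.exp_add]
              ring_nf
    _ = _ := by
        rw [lintegral_const_mul' _ _ ENNReal.ofReal_ne_top, h2,
          ← ENNReal.ofReal_mul (Real.exp_pos _).le]
        congr 1
        ring

theorem one_le_V (f : ℝ≥0 ≃o ℝ≥0) (ha : 0 < a) (hb : 0 < b) (x : ℝ≥0) : 1 ≤ V f a b x := by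
  rw [V]
  refine Real.one_le_exp ?_
  have : 0 < b + 1 := by linarith
  positivity

theorem measurable_V (f : ℝ≥0 ≃o ℝ≥0) : Measurable (V f a b) := by
  have : Continuous f := f.continuous
  unfold V
  fun_prop

/-- A sublinear power is dominated by half the identity, up to a constant. -/
theorem exists_rpow_div_le {θ : ℝ} (hθ0 : 0 < θ) (hθ1 : θ < 1) :
    ∃ C : ℝ, 0 < C ∧ ∀ v : ℝ, 1 ≤ v → v ^ θ / (1 - θ) ≤ 1 / 2 * v + C := by
  have h1 : 0 < 1 - θ := by linarith
  -- From v₀ on, v^(1-θ) ≥ 2/(1-θ), so half of v dominates; below v₀ the constant does.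
  set v₀ : ℝ := (2 / (1 - θ)) ^ (1 / (1 - θ)) with hv₀
  have hv₀0 : 0 < v₀ := Real.rpow_pos_of_pos (by positivity) _
  refine ⟨v₀ ^ θ / (1 - θ), div_pos (Real.rpow_pos_of_pos hv₀0 _) h1, fun v hv => ?_⟩
  have hv0 : 0 < v := by linarith
  rcases le_total v v₀ with h | h
  · have : v ^ θ / (1 - θ) ≤ v₀ ^ θ / (1 - θ) := by gcongr
    linarith
  · have h2 : 2 / (1 - θ) ≤ v ^ (1 - θ) := by
      calc 2 / (1 - θ) = v₀ ^ (1 - θ) := by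
            rw [hv₀, ← Real.rpow_mul (by positivity), one_div, inv_mul_cancel₀ h1.ne', Real.rpow_one]
        _ ≤ v ^ (1 - θ) := by gcongr
    have h3 : v ^ θ * v ^ (1 - θ) = v := by
      rw [← Real.rpow_add hv0, add_sub_cancel, Real.rpow_one]
    have h4 : v ^ θ * (2 / (1 - θ)) ≤ v := by
      calc _ ≤ v ^ θ * v ^ (1 - θ) := by gcongr
        _ = v := h3
    have h5 : v ^ θ / (1 - θ) = 1 / 2 * (v ^ θ * (2 / (1 - θ))) := by field_simp
    have : 0 ≤ v₀ ^ θ / (1 - θ) := by positivity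
    linarith

/-- The drift condition, with constants that are uniform over the class of jump rates. -/
theorem Assumptions.exists_drift (hyp : Assumptions φ f κ m M) (r : ℝ≥0) (ha : 0 < a) (hb : 0 < b)
    (L : ℝ) :
    ∃ C : ℝ, 0 < C ∧ ∀ rate ∈ rateClass f m M r L a b,
      Drift (jumpKernel φ f rate) (V f a b) (1 / 2) C := by
  have hb1 : 0 < b + 1 := by linarith
  set θ := κ ^ (b + 1) with hθ
  have hθ0 : 0 < θ := Real.rpow_pos_of_pos hyp.kappa_pos _
  have hθ1 : θ < 1 := Real.rpow_lt_one hyp.kappa_pos.le hyp.kappa_lt_one hb1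
  obtain ⟨C, hC, hCv⟩ := exists_rpow_div_le hθ0 hθ1
  have h1θ : 0 < 1 - θ := by linarith
  -- With q = f y the moment bound is V(y)^θ / (1 - θ). Since q is the larger of f x and f r, the
  -- case y = x gives the sublinear term and y = r a constant.
  have hE : ∀ y : ℝ≥0, Real.exp (a / (b + 1) * θ * (f y : ℝ) ^ (b + 1)) = V f a b y ^ θ := by
    intro y
    rw [V, ← Real.exp_mul]
    ring_nf
  refine ⟨C + V f a b r ^ θ / (1 - θ), ?_, fun rate hrate x => ?_⟩
  · have : 0 < V f a b r := zero_lt_one.trans_le (one_le_V f ha hb r)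
    positivity
  · have hV0 : ∀ y, 0 < V f a b y := fun y => zero_lt_one.trans_le (one_le_V f ha hb y)
    refine integrable_and_integral_le (measurable_V f) (fun y => (hV0 y).le) ?_ ?_
    · have := hV0 x
      have := hV0 r
      positivity
    · refine (hyp.lintegral_V_le ha hb hrate x (le_max_left _ (f r : ℝ))
        (le_max_right (f x : ℝ) _)).trans (ENNReal.ofReal_le_ofReal ?_)
      rw [← hθ]
      have h1 := hCv _ (one_le_V f ha hb x)
      have hpx : 0 ≤ V f a b x ^ θ / (1 - θ) := by have := hV0 x; positivity
      have hpr : 0 ≤ V f a b r ^ θ / (1 - θ) := by have := hV0 r; positivity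
      have := hV0 x
      rcases max_choice (f x : ℝ) (f r : ℝ) with h | h <;> rw [h, hE]
      · linarith
      · linarith

theorem Assumptions.jumpKernel_Ioi_le (hyp : Assumptions φ f κ m M) (ha : 0 < a) (hb : 0 < b)
    (hrate : rate ∈ rateClass f m M r L a b) (x : ℝ≥0) {q : ℝ} {y : ℝ≥0} (hqx : (f x : ℝ) ≤ q)
    (hqr : (f r : ℝ) ≤ q) (hqy : q ≤ y) :
    jumpKernel φ f rate x (Ioi y) ≤
      ENNReal.ofReal (Real.exp (-(a / (b + 1) * ((y : ℝ) ^ (b + 1) - q ^ (b + 1))))) := by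
  have hm : Measurable ((Ioi y).indicator (1 : ℝ≥0 → ℝ≥0∞)) :=
    measurable_one.indicator measurableSet_Ioi
  rw [← lintegral_indicator_one measurableSet_Ioi, hyp.isFlow.lintegral_jumpKernel f hrate.1 x hm]
  have h1 := hyp.lintegral_exp_hazard ha hb hrate x one_pos (jumpTime φ f x y)
  simp only [one_mul, div_one] at h1
  have hle : ∫⁻ t in Ioi (0 : ℝ),
      ENNReal.ofReal (rate (φ x t.toNNReal) * Real.exp (-hazard φ rate x t)) *
        (Ioi y).indicator 1 (jumpLocation φ f x t.toNNReal) ≤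
      ∫⁻ t in Ioi (jumpTime φ f x y),
        ENNReal.ofReal (rate (φ x t.toNNReal) * Real.exp (-hazard φ rate x t)) := by
    rw [← lintegral_indicator measurableSet_Ioi, ← lintegral_indicator measurableSet_Ioi]
    refine lintegral_mono fun t => ?_
    by_cases ht : t ∈ Ioi (0 : ℝ)
    · by_cases hy : jumpLocation φ f x t.toNNReal ∈ Ioi y
      · have htτ : t ∈ Ioi (jumpTime φ f x y) := by
          rw [mem_Ioi, ← Real.coe_toNNReal t (mem_Ioi.1 ht).le,
            ← hyp.isFlow.jumpTime_jumpLocation f x t.toNNReal]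
          have hyx : (f x : ℝ) ≤ y := hqx.trans hqy
          have hlt : (y : ℝ) < jumpLocation φ f x t.toNNReal := by exact_mod_cast mem_Ioi.1 hy
          exact hyp.isFlow.strictMonoOn_jumpTime f x hyx (hyx.trans hlt.le) hlt
        simp [ht, hy, htτ]
      · rw [indicator_of_mem ht, indicator_of_notMem hy, mul_zero]
        exact zero_le
    · simp [ht]
  refine hle.trans (h1.le.trans (ENNReal.ofReal_le_ofReal (Real.exp_le_exp.2 (neg_le_neg ?_))))
  exact hyp.rpow_sub_le_hazardAt ha hb hrate x hqx hqr hqy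

/-- With a probability bounded below, a jump brings the process closer to `[0, r]`. -/
theorem Assumptions.exists_descent (hyp : Assumptions φ f κ m M) {r : ℝ≥0} (hr : 0 < r)
    (ha : 0 < a) (hb : 0 < b) (L : ℝ) :
    ∃ (p : ℝ≥0∞) (κ' : ℝ≥0), 0 < p ∧ p ≤ 1 ∧ κ' < 1 ∧ ∀ rate ∈ rateClass f m M r L a b,
      ∀ x, p ≤ jumpKernel φ f rate x (Iic (κ' * max x r)) := by
  have hb1 : 0 < b + 1 := by linarith
  have hκ0 := hyp.kappa_pos
  have hκ1 := hyp.kappa_lt_one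
  -- Any factor strictly between κ and 1 works: the hazard accumulated between κ max(x, r) and k
  -- max(x, r) is at least w > 0, because the maximum is at least r.
  set k : ℝ≥0 := ⟨(1 + κ) / 2, by linarith⟩ with hk
  have hkv : (k : ℝ) = (1 + κ) / 2 := rfl
  set w := a / (b + 1) * (((k : ℝ) ^ (b + 1) - κ ^ (b + 1)) * (r : ℝ) ^ (b + 1)) with hw
  have hr0 : (0 : ℝ) < r := hr
  have hkκ : κ ^ (b + 1) < (k : ℝ) ^ (b + 1) :=
    Real.rpow_lt_rpow hκ0.le (by rw [hkv]; linarith) hb1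
  have hw0 : 0 < w := by
    have := Real.rpow_pos_of_pos hr0 (b + 1)
    have : 0 < (k : ℝ) ^ (b + 1) - κ ^ (b + 1) := by linarith
    positivity
  have hexp : Real.exp (-w) < 1 := Real.exp_lt_one_iff.2 (by linarith)
  refine ⟨1 - ENNReal.ofReal (Real.exp (-w)), k, ?_, tsub_le_self, ?_, fun rate hrate x => ?_⟩
  · exact tsub_pos_of_lt (ENNReal.ofReal_lt_one.2 hexp)
  · rw [← NNReal.coe_lt_coe, hkv, NNReal.coe_one]; linarith
  have := hyp.isMarkovKernel_jumpKernel ha hb hrate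
  set y := k * max x r with hy
  have hmap : ∀ z, (f z : ℝ) ≤ κ * z := fun z => by
    rcases eq_zero_or_pos z with rfl | hz
    · have : f 0 = 0 := f.map_bot
      simp [this]
    · exact (hyp.map_le z hz).2
  have hyv : (y : ℝ) = k * max (x : ℝ) r := by rw [hy]; push_cast; rfl
  have hmax : (r : ℝ) ≤ max (x : ℝ) r := le_max_right _ _
  have hmax0 : 0 ≤ max (x : ℝ) r := hr0.le.trans hmax
  have htail := hyp.jumpKernel_Ioi_le ha hb hrate x (q := κ * max (x : ℝ) r) (y := y)
    ((hmap x).trans (by gcongr; exact le_max_left _ _))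
    ((hmap r).trans (by gcongr))
    (by rw [hyv, hkv]; gcongr; linarith)
  have hle : Real.exp (-(a / (b + 1) * ((y : ℝ) ^ (b + 1) - (κ * max (x : ℝ) r) ^ (b + 1)))) ≤
      Real.exp (-w) := by
    refine Real.exp_le_exp.2 (neg_le_neg ?_)
    rw [hw, hyv, Real.mul_rpow k.coe_nonneg hmax0, Real.mul_rpow hκ0.le hmax0, ← sub_mul]
    have : 0 ≤ (k : ℝ) ^ (b + 1) - κ ^ (b + 1) := by linarith
    gcongr
  have hcompl : Iic y = (Ioi y)ᶜ := compl_Ioi.symm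
  rw [hcompl, prob_compl_eq_one_sub measurableSet_Ioi]
  exact tsub_le_tsub_left (htail.trans (ENNReal.ofReal_le_ofReal hle)) 1

/-- Each successful step lowers by one the number of contractions still required; the maximum with r
covers a chain that is already in [0, r], which a successful step keeps there. -/
theorem pow_le_jumpKernel_pow_Iic {P : Kernel ℝ≥0 ℝ≥0} {p : ℝ≥0∞} {k r : ℝ≥0} (hk : k ≤ 1)
    (h : ∀ x, p ≤ P x (Iic (k * max x r))) (n : ℕ) (x : ℝ≥0) (hx : k ^ n * x ≤ r) :
    p ^ n ≤ (P ^ n) x (Iic r) := by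
  induction n generalizing x with
  | zero =>
    rw [pow_zero_kernel_apply, pow_zero, Measure.dirac_apply' _ measurableSet_Iic]
    have : x ∈ Iic r := by simpa using hx
    simp [this]
  | succ n ih =>
    have hsub : ∀ z ∈ Iic (k * max x r), p ^ n ≤ (P ^ n) z (Iic r) := by
      intro z hz
      refine ih z ?_
      calc k ^ n * z ≤ k ^ n * (k * max x r) := by gcongr; exact hz
        _ = max (k ^ (n + 1) * x) (k ^ (n + 1) * r) := by
            rw [← mul_assoc, ← pow_succ, mul_max]
        _ ≤ r := max_le hx (mul_le_of_le_one_left' (pow_le_one' hk _))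
    rw [add_comm n 1, Kernel.pow_add_apply_eq_lintegral P 1 n x measurableSet_Iic, pow_one]
    calc p ^ (1 + n) = p ^ n * p := by rw [add_comm, pow_succ]
      _ ≤ p ^ n * P x (Iic (k * max x r)) := by gcongr; exact h x
      _ = ∫⁻ _ in Iic (k * max x r), p ^ n ∂(P x) := by rw [setLIntegral_const]
      _ ≤ ∫⁻ z in Iic (k * max x r), (P ^ n) z (Iic r) ∂(P x) :=
          setLIntegral_mono' measurableSet_Iic hsub
      _ ≤ _ := setLIntegral_le_lintegral _ _

/-- The density formula for the post-jump location. -/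
theorem Assumptions.lintegral_jumpKernel_eq (hyp : Assumptions φ f κ m M)
    (hrate : Continuous rate) (x : ℝ≥0) {F : ℝ≥0 → ℝ≥0∞} (hF : Measurable F) :
    ∫⁻ z, F z ∂(jumpKernel φ f rate x) = ∫⁻ u in Ioi (f x : ℝ),
      ENNReal.ofReal (invDeriv φ f x u.toNNReal * (rate (f.symm u.toNNReal) *
        Real.exp (-hazardAt φ f rate x u))) * F u.toNNReal := by
  rw [hyp.isFlow.lintegral_jumpKernel f hrate x hF, ← hyp.isFlow.image_jumpTime_Ioi f x,
    lintegral_image_eq_lintegral_abs_deriv_mul measurableSet_Ioi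
      (fun u hu => (hyp.hasDerivAt_jumpTime x hu).hasDerivWithinAt)
      ((hyp.isFlow.strictMonoOn_jumpTime f x).injOn.mono Ioi_subset_Ici_self)]
  refine setLIntegral_congr_fun measurableSet_Ioi fun u hu => ?_
  have hg : 0 ≤ invDeriv φ f x u.toNNReal :=
    (hyp.m_pos _).le.trans (hyp.invDeriv_bounds x hu).1
  have hux : (f x : ℝ) ≤ u := (mem_Ioi.1 hu).le
  rw [hyp.isFlow.path_jumpTime f x hux, hyp.isFlow.jumpLocation_jumpTime f x hux,
    abs_of_nonneg hg, ← mul_assoc, ← ENNReal.ofReal_mul hg]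
  rfl

theorem Assumptions.jumpKernel_absolutelyContinuous (hyp : Assumptions φ f κ m M)
    (hrate : Continuous rate) (x : ℝ≥0) : jumpKernel φ f rate x ≪ halfLine := by
  refine Measure.AbsolutelyContinuous.mk fun A hA h0 => ?_
  have hm : Measurable (A.indicator (1 : ℝ≥0 → ℝ≥0∞)) := measurable_one.indicator hA
  rw [← lintegral_indicator_one hA, lintegral_halfLine hm,
    lintegral_eq_zero_iff (show Measurable fun t : ℝ => A.indicator (1 : ℝ≥0 → ℝ≥0∞) t.toNNReal from
      hm.comp measurable_real_toNNReal)] at h0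
  rw [← lintegral_indicator_one hA, hyp.lintegral_jumpKernel_eq hrate x hm]
  have h1 := ae_restrict_of_ae_restrict_of_subset (s := Ioi (f x : ℝ))
    (Ioi_subset_Ioi (f x).2) h0
  rw [← lintegral_zero (μ := (volume : Measure ℝ).restrict (Ioi (f x : ℝ)))]
  refine lintegral_congr_ae ?_
  filter_upwards [h1] with u hu
  rw [Pi.zero_apply] at hu
  rw [hu, mul_zero]

/-- The minorization condition on `[0, r]`, uniformly over the class of jump rates. -/
theorem Assumptions.exists_minorization (hyp : Assumptions φ f κ m M) {r : ℝ≥0} (hr : 0 < r)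
    (ha : 0 < a) (hb : 0 < b) (L : ℝ) :
    ∃ ε : ℝ≥0∞, 0 < ε ∧ ∀ rate ∈ rateClass f m M r L a b, ∃ μ : Measure ℝ≥0,
      ε ≤ μ univ ∧ ∀ x ≤ r, μ ≤ jumpKernel φ f rate x := by
  set q : ℝ := ((f r : ℝ≥0) : ℝ) with hq
  have hq0 : 0 < q := (hyp.map_le r hr).1
  obtain ⟨u₁, -, hu₁⟩ := isCompact_Icc.exists_isMinOn (nonempty_Icc.2 (show q ≤ q + 1 by linarith))
    (hyp.continuous_m.comp continuous_real_toNNReal).continuousOn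
  obtain ⟨u₂, -, hu₂⟩ := isCompact_Icc.exists_isMaxOn (nonempty_Icc.2 (show q ≤ q + 1 by linarith))
    (hyp.continuous_M.comp continuous_real_toNNReal).continuousOn
  set c₁ := m u₁.toNNReal with hc₁
  set c₂ := M u₂.toNNReal with hc₂
  have hc₁0 : 0 < c₁ := hyp.m_pos _
  have hc₂0 : 0 < c₂ := (hyp.m_pos _).trans_le (hyp.m_le_M _)
  -- On a compact window m and M are comparable. Trading m for M makes the minorizing density an
  -- exact derivative, W exp(-N) with N' = W, so its mass is computable without any upper bound on
  -- λ.
  have hcm : ∀ u ∈ Icc q (q + 1), c₁ / c₂ * M u.toNNReal ≤ m u.toNNReal := by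
    intro u hu
    have h1 : c₁ ≤ m u.toNNReal := hu₁ hu
    have h2 : M u.toNNReal ≤ c₂ := hu₂ hu
    calc c₁ / c₂ * M u.toNNReal ≤ c₁ / c₂ * c₂ := by gcongr
      _ = c₁ := by field_simp
      _ ≤ _ := h1
  set c := c₁ / c₂ * Real.exp (-L) with hc
  have hc0 : 0 < c := by positivity
  have hδ : Real.exp (-(a * q ^ b)) < 1 := Real.exp_lt_one_iff.2 (by
    have := Real.rpow_pos_of_pos hq0 b
    have : 0 < a * q ^ b := by positivity
    linarith)
  refine ⟨ENNReal.ofReal (c * (1 - Real.exp (-(a * q ^ b)))),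
    ENNReal.ofReal_pos.2 (mul_pos hc0 (by linarith)), fun rate hrate => ?_⟩
  set W : ℝ → ℝ := fun u => M u.toNNReal * (rate (f.symm u.toNNReal) : ℝ) with hW
  have hWc : Continuous W := hyp.continuous_weighted_rate hrate.1
  set N : ℝ → ℝ := fun u => ∫ v in q..u, W v with hN
  have hNd : ∀ u, HasDerivAt N (W u) u := fun u =>
    intervalIntegral.integral_hasDerivAt_right (hWc.intervalIntegrable _ _)
      (hWc.stronglyMeasurableAtFilter _ _) hWc.continuousAt
  have hNc : Continuous N := continuous_iff_continuousAt.2 fun u => (hNd u).continuousAt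
  set dens : ℝ → ℝ := fun u => c * (W u * Real.exp (-N u)) with hdens
  have hdc : Continuous dens := by fun_prop
  have hW0 : ∀ u, 0 ≤ W u := fun u =>
    mul_nonneg ((hyp.m_pos _).le.trans (hyp.m_le_M _)) (NNReal.coe_nonneg _)
  have hd0 : ∀ u, 0 ≤ dens u := fun u => by
    have := hW0 u
    positivity
  set μ : Measure ℝ≥0 := ((volume.restrict (Ioc q (q + 1))).withDensity
    fun u => ENNReal.ofReal (dens u)).map Real.toNNReal with hμ
  have hdm : Measurable fun u => ENNReal.ofReal (dens u) := hdc.measurable.ennreal_ofReal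
  have hμF : ∀ F : ℝ≥0 → ℝ≥0∞, Measurable F →
      ∫⁻ z, F z ∂μ = ∫⁻ u in Ioc q (q + 1), ENNReal.ofReal (dens u) * F u.toNNReal := by
    intro F hF
    have hF' : Measurable fun u : ℝ => F u.toNNReal := hF.comp measurable_real_toNNReal
    rw [hμ, lintegral_map hF measurable_real_toNNReal,
      lintegral_withDensity_eq_lintegral_mul _ hdm hF']
    rfl
  refine ⟨μ, ?_, fun x hx => Measure.le_iff.2 fun A hA => ?_⟩
  · have h1 := hμF (fun _ => 1) measurable_const
    rw [lintegral_one] at h1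
    rw [h1]
    simp only [mul_one]
    rw [← ofReal_integral_eq_lintegral_ofReal
      ((hdc.integrableOn_Icc (a := q) (b := q + 1)).mono_set Ioc_subset_Icc_self)
      (ae_of_all _ hd0), ← intervalIntegral.integral_of_le (by linarith)]
    refine ENNReal.ofReal_le_ofReal ?_
    have h2 : ∫ u in q..(q + 1), dens u = c * (1 - Real.exp (-N (q + 1))) := by
      rw [intervalIntegral.integral_eq_sub_of_hasDerivAt (f := fun u => -(c * Real.exp (-N u)))
        (fun u _ => ?_) (hdc.intervalIntegrable _ _)]
      · have : N q = 0 := intervalIntegral.integral_same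
        rw [this, neg_zero, Real.exp_zero]
        ring
      · refine (((hNd u).neg.exp.const_mul c).neg).congr_deriv ?_
        simp only [hdens, Pi.neg_apply]
        ring
    rw [h2]
    -- The growth imposed by the class on a window of length 1 bounds the mass below uniformly in λ.
    have h3 : a * q ^ b ≤ N (q + 1) := by
      have : ∫ _ in q..(q + 1), a * q ^ b = a * q ^ b := by simp
      rw [← this]
      refine intervalIntegral.integral_mono_on (by linarith) (by simp)
        (hWc.intervalIntegrable _ _) fun u hu => ?_
      calc a * q ^ b ≤ a * u ^ b := by
            have := hu.1
            gcongr
        _ ≤ rate (f.symm u.toNNReal) * m u.toNNReal := hyp.rate_lower_bound ha hrate hu.1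
        _ ≤ rate (f.symm u.toNNReal) * M u.toNNReal := by
            gcongr
            exact hyp.m_le_M _
        _ = W u := mul_comm _ _
    gcongr
  · have hm : Measurable (A.indicator (1 : ℝ≥0 → ℝ≥0∞)) := measurable_one.indicator hA
    rw [← lintegral_indicator_one hA, ← lintegral_indicator_one hA, hμF _ hm,
      hyp.lintegral_jumpKernel_eq hrate.1 x hm]
    have hxr : (f x : ℝ) ≤ q := by exact_mod_cast f.monotone hx
    refine le_trans ?_ (lintegral_mono_set
      ((show Ioc q (q + 1) ⊆ Ioi q from Ioc_subset_Ioi_self).trans (Ioi_subset_Ioi hxr)))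
    refine setLIntegral_mono' measurableSet_Ioc fun u hu => ?_
    gcongr ENNReal.ofReal ?_ * _
    have hux : (f x : ℝ) < u := hxr.trans_lt hu.1
    have hg := (hyp.invDeriv_bounds x hux).1
    -- The hazard up to q = f(r) costs at most L, whence the factor exp(-L) in c; the rest is N,
    -- which does not depend on x.
    have hD : hazardAt φ f rate x u ≤ L + N u := by
      refine (hyp.hazardAt_le hrate.1 x hux.le).trans ?_
      rw [← intervalIntegral.integral_add_adjacent_intervals (b := q)
        (hWc.intervalIntegrable _ _) (hWc.intervalIntegrable _ _)]
      exact add_le_add_left hrate.2.2 _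
    calc dens u = (c₁ / c₂ * M u.toNNReal) *
          (rate (f.symm u.toNNReal) * (Real.exp (-L) * Real.exp (-N u))) := by
          simp only [hdens, hW, hc]; ring
      _ = (c₁ / c₂ * M u.toNNReal) * (rate (f.symm u.toNNReal) * Real.exp (-(L + N u))) := by
          rw [← Real.exp_add, neg_add]
      _ ≤ invDeriv φ f x u.toNNReal *
          (rate (f.symm u.toNNReal) * Real.exp (-hazardAt φ f rate x u)) := by
          have h1 := (hcm u (Ioc_subset_Icc_self hu)).trans hg
          have h2 : 0 ≤ c₁ / c₂ * M u.toNNReal := by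
            have := (hyp.m_pos u.toNNReal).trans_le (hyp.m_le_M _)
            positivity
          gcongr
          exact h2.trans h1

/-- A multi-step minorization on the sublevel sets of `V`, uniformly over the class of jump
rates. -/
theorem Assumptions.exists_minorization_pow (hyp : Assumptions φ f κ m M) {r : ℝ≥0} (hr : 0 < r)
    (ha : 0 < a) (hb : 0 < b) (L d : ℝ) :
    ∃ (ε : ℝ) (N : ℕ), 0 < ε ∧ ε ≤ 1 ∧ 1 ≤ N ∧ ∀ rate ∈ rateClass f m M r L a b,
      ∃ μ : Measure ℝ≥0, IsFiniteMeasure μ ∧ ε ≤ μ.real univ ∧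
        ∀ x, V f a b x ≤ d → μ ≤ (jumpKernel φ f rate ^ N) x := by
  have hb1 : 0 < b + 1 := by linarith
  obtain ⟨p, k, hp0, hp1, hk, hdesc⟩ := hyp.exists_descent hr ha hb L
  obtain ⟨ε, hε0, hmin⟩ := hyp.exists_minorization hr ha hb L
  -- a bound for the sublevel set
  obtain ⟨X, hX⟩ : ∃ X : ℝ≥0, ∀ x, V f a b x ≤ d → x ≤ X := by
    have hlim : Tendsto (fun y : ℝ => Real.exp (a / (b + 1) * y ^ (b + 1))) atTop atTop :=
      Real.tendsto_exp_atTop.comp ((tendsto_rpow_atTop hb1).const_mul_atTop (by positivity))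
    obtain ⟨y, hy, hy0⟩ := ((hlim.eventually_gt_atTop d).and (eventually_ge_atTop 0)).exists
    refine ⟨f.symm y.toNNReal, fun x hx => (OrderIso.le_symm_apply f).2 ?_⟩
    by_contra! hlt
    have h1 : y < f x := (Real.toNNReal_lt_iff_lt_coe hy0).1 hlt
    have h2 : Real.exp (a / (b + 1) * y ^ (b + 1)) ≤ V f a b x := by
      rw [V]
      gcongr
    linarith
  obtain ⟨n, hn⟩ : ∃ n : ℕ, k ^ n * X ≤ r := by
    have hlim : Tendsto (fun n : ℕ => k ^ n * X) atTop (𝓝 (0 * X)) :=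
      (NNReal.tendsto_pow_atTop_nhds_zero_of_lt_one hk).mul_const X
    rw [zero_mul] at hlim
    exact ((hlim.eventually (gt_mem_nhds hr)).exists).imp fun n h => h.le
  have hpn : 0 < p ^ n * ε := ENNReal.mul_pos (pow_ne_zero n hp0.ne') hε0.ne'
  have hpntop : p ^ n ≠ ∞ := ENNReal.pow_ne_top (hp1.trans_lt ENNReal.one_lt_top).ne
  -- There are n steps to enter [0, r] and one for the minorization. The minimum with 1 gives
  -- finiteness before passing to a real number, and the bound by 1 that the contraction asks for.
  refine ⟨(min 1 (p ^ n * ε)).toReal, n + 1, ?_, ?_, by omega, fun rate hrate => ?_⟩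
  · exact ENNReal.toReal_pos (lt_min one_pos hpn).ne' (min_lt_of_left_lt ENNReal.one_lt_top).ne
  · exact ENNReal.toReal_le_of_le_ofReal zero_le_one (by simp)
  · have := hyp.isMarkovKernel_jumpKernel ha hb hrate
    obtain ⟨μ, hμε, hμ⟩ := hmin rate hrate
    have hμfin : IsFiniteMeasure μ := isFiniteMeasure_of_le _ (hμ 0 zero_le)
    have hfin : IsFiniteMeasure (p ^ n • μ) := Measure.smul_finite μ hpntop
    refine ⟨p ^ n • μ, hfin, ?_, fun x hx => Measure.le_iff.2 fun A hA => ?_⟩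
    · refine ENNReal.toReal_mono (measure_ne_top _ _) ((min_le_right _ _).trans ?_)
      rw [Measure.smul_apply, smul_eq_mul]
      gcongr
    · rw [Kernel.pow_succ_apply_eq_lintegral _ _ _ hA, Measure.smul_apply, smul_eq_mul]
      have h1 : p ^ n ≤ (jumpKernel φ f rate ^ n) x (Iic r) :=
        pow_le_jumpKernel_pow_Iic hk.le (hdesc rate hrate) n x
          ((mul_le_mul_right (hX x hx) _).trans hn)
      calc p ^ n * μ A ≤ (jumpKernel φ f rate ^ n) x (Iic r) * μ A := by gcongr
        _ = ∫⁻ _ in Iic r, μ A ∂((jumpKernel φ f rate ^ n) x) := by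
            rw [setLIntegral_const, mul_comm]
        _ ≤ ∫⁻ z in Iic r, jumpKernel φ f rate z A ∂((jumpKernel φ f rate ^ n) x) :=
            setLIntegral_mono' measurableSet_Iic fun z hz => hμ z hz A
        _ ≤ _ := setLIntegral_le_lintegral _ _

end JumpKernel

/-! ### Assembly: uniform ergodicity and the main theorem. -/

theorem integral_densityMeasure {p : ℝ≥0 → ℝ≥0} (hp : Measurable p) (ψ : ℝ≥0 → ℝ) :
    ∫ z, ψ z ∂(densityMeasure p) = ∫ z, ψ z * p z ∂halfLine := by
  rw [densityMeasure, integral_withDensity_eq_integral_smul hp]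
  simp_rw [NNReal.smul_def, smul_eq_mul, mul_comm]

theorem IsJumpChain.isMarkovChain {Ω : Type*} [MeasurableSpace Ω] {P : Measure Ω}
    {φ : ℝ≥0 → ℝ≥0 → ℝ≥0} {f : ℝ≥0 ≃o ℝ≥0} {rate : ℝ≥0 → ℝ≥0} {x₀ : ℝ≥0} {Z : ℕ → Ω → ℝ≥0}
    (h : IsJumpChain P φ f rate x₀ Z) : IsMarkovChain P (jumpKernel φ f rate) x₀ Z :=
  ⟨h.measurable, h.init, h.transition⟩

/-- Existence, integrability and geometric ergodicity, with constants that are uniform over the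
class of jump rates. -/
theorem Assumptions.exists_uniform_ergodicity {φ : ℝ≥0 → ℝ≥0 → ℝ≥0} {f : ℝ≥0 ≃o ℝ≥0} {κ : ℝ}
    {m M : ℝ≥0 → ℝ} (hyp : Assumptions φ f κ m M) {r : ℝ≥0} {a b : ℝ} (hr : 0 < r) (ha : 0 < a)
    (hb : 0 < b) (L : ℝ) :
    ∃ R γ D : ℝ, 0 < R ∧ 0 < γ ∧ γ < 1 ∧ ∀ rate ∈ rateClass f m M r L a b, ∃ p : ℝ≥0 → ℝ≥0,
      IsUniqueInvariantDensity (jumpKernel φ f rate) p ∧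
      Integrable (V f a b) (densityMeasure p) ∧ ∫ z, V f a b z ∂(densityMeasure p) ≤ D ∧
      GeometricErgodicity (jumpKernel φ f rate) (densityMeasure p) (V f a b) R γ := by
  obtain ⟨C, hC, hdrift⟩ := hyp.exists_drift r ha hb L
  -- With η = 1/2 the contraction requires d > 8C.
  set d := 8 * C + 1 with hd
  obtain ⟨ε, N, hε0, hε1, hN, hmin⟩ := hyp.exists_minorization_pow hr ha hb L d
  obtain ⟨R, γ, hR, hγ0, hγ1, hosc⟩ := exists_geometric_oscillation (η := 1 / 2) (C := C) (d := d)
    hN (by norm_num) (by norm_num) hC hε0 hε1 (by rw [hd]; norm_num; linarith)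
  set D := C / (1 - 1 / 2) with hD
  have hD0 : 0 < D := by rw [hD]; norm_num; exact hC
  have hV := measurable_V (a := a) (b := b) f
  have hV1 := one_le_V (a := a) (b := b) f ha hb
  have hV0 : ∀ x, 0 ≤ V f a b x := fun x => zero_le_one.trans (hV1 x)
  -- Since V ≥ 1 and its stationary mean is at most D, the sum of V(x) and that mean is at most (1 +
  -- D) V(x).
  refine ⟨R * (1 + D), γ, D, by positivity, hγ0, hγ1, fun rate hrate => ?_⟩
  have := hyp.isMarkovKernel_jumpKernel ha hb hrate
  have hdr := hdrift rate hrate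
  obtain ⟨μ, hμfin, hμε, hμ⟩ := hmin rate hrate
  have hgo : GeometricOscillation (jumpKernel φ f rate) (V f a b) R γ :=
    hosc hV hV1 (jumpKernel φ f rate) μ hdr hμε hμ
  obtain ⟨p, hp, hprob, hinv⟩ := hgo.exists_invariant_density hR.le hγ0.le hγ1 hV hV1
    (by norm_num) (by norm_num) hC.le hdr halfLine
    (fun x => hyp.jumpKernel_absolutelyContinuous hrate.1 x)
  change IsProbabilityMeasure (densityMeasure p) at hprob
  change (jumpKernel φ f rate).Invariant (densityMeasure p) at hinv
  have hint : ∀ π : Measure ℝ≥0, IsProbabilityMeasure π → (jumpKernel φ f rate).Invariant π →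
      Integrable (V f a b) π ∧ ∫ x, V f a b x ∂π ≤ D := fun π _ hπ =>
    integral_le_of_invariant hV hV0 (by norm_num) (by norm_num) hC.le hdr hπ
  obtain ⟨hVi, hVD⟩ := hint _ hprob hinv
  refine ⟨p, ⟨hp, hprob, hinv, fun π hπ hπi => ?_⟩, hVi, hVD, fun k x => ⟨?_, fun ψ hψ hψV => ?_⟩⟩
  · exact hgo.invariant_unique hγ0.le hγ1 hV1 hπi hinv (hint π hπ hπi).1 hVi
  · exact (hdr.pow hV hV0 (by norm_num) (by norm_num) hC.le k x).1
  · refine (hgo.abs_sub_invariant_le hinv hVi hψ hψV k x).trans ?_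
    have h1 : V f a b x + ∫ z, V f a b z ∂(densityMeasure p) ≤ (1 + D) * V f a b x := by
      have := mul_le_mul_of_nonneg_left (hV1 x) hD0.le
      linarith
    calc R * γ ^ k * (V f a b x + ∫ z, V f a b z ∂(densityMeasure p))
        ≤ R * γ ^ k * ((1 + D) * V f a b x) := by gcongr
      _ = _ := by ring

end PDMP

theorem mainTheorem8 (φ : ℝ≥0 → ℝ≥0 → ℝ≥0) (f : ℝ≥0 ≃o ℝ≥0) (κ : ℝ) (m M : ℝ≥0 → ℝ)
    (hyp : PDMP.Assumptions φ f κ m M)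
    (r : ℝ≥0) (L a b : ℝ) (hpar : PDMP.Parameters f κ r L a b) :
    ∃ (R γ : ℝ) (ν : (ℝ≥0 → ℝ≥0) → ℝ≥0 → ℝ≥0),
      0 < R ∧ 0 < γ ∧ γ < 1 ∧
      -- `ν rate` is the invariant density, and `R`, `γ` are constants of the uniform contraction
      (∀ rate ∈ PDMP.rateClass f m M r L a b,
        PDMP.IsUniqueInvariantDensity (PDMP.jumpKernel φ f rate) (ν rate) ∧
        Integrable (fun x => PDMP.V f a b x * ν rate x) PDMP.halfLine ∧
        ∀ (k : ℕ) (x : ℝ≥0),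
          Integrable (PDMP.V f a b) ((PDMP.jumpKernel φ f rate ^ k) x) ∧
          ∀ ψ : ℝ≥0 → ℝ, Measurable ψ → (∀ z, |ψ z| ≤ PDMP.V f a b z) →
            |∫ z, ψ z ∂((PDMP.jumpKernel φ f rate ^ k) x) - ∫ z, ψ z * ν rate z ∂PDMP.halfLine|
              ≤ R * PDMP.V f a b x * γ ^ k) ∧
      -- `G` is bounded uniformly over the class
      (∀ z : ℝ≥0, ∃ C : ℝ, ∀ rate ∈ PDMP.rateClass f m M r L a b,
        PDMP.G f a b R γ (ν rate) z ≤ C) ∧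
      -- the bias and variance bounds
      ∀ x₀ : ℝ≥0, ∃ c : ℝ, ∀ rate ∈ PDMP.rateClass f m M r L a b,
        ∀ (Ω : Type*) [MeasurableSpace Ω] (P : Measure Ω) [IsProbabilityMeasure P]
          (Z : ℕ → Ω → ℝ≥0), PDMP.IsJumpChain P φ f rate x₀ Z →
        ∀ s : ℝ≥0 → ℝ, Measurable s → BddAbove (Set.range fun x => |s x|) →
        ∀ n : ℕ, 1 ≤ n →
          |∫ ω, ((1 / n : ℝ) * ∑ k ∈ Finset.Icc 1 n, s (Z k ω)
              - ∫ x, s x * ν rate x ∂PDMP.halfLine) ∂P|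
            ≤ PDMP.supNorm s * (R * PDMP.V f a b x₀ / (n * (1 - γ))) ∧
          variance (fun ω => (1 / n : ℝ) * ∑ k ∈ Finset.Icc 1 n, s (Z k ω)) P
            ≤ 1 / n * ∫ z, s z ^ 2 * ν rate z ∂PDMP.halfLine
              + PDMP.supNorm s / n *
                ∫ z, |s z| * ν rate z * PDMP.G f a b R γ (ν rate) z ∂PDMP.halfLine
              + c * PDMP.supNorm s ^ 2 / n ^ 2 := by
  
  obtain ⟨R₀, γ, D, hR₀, hγ0, hγ1, herg⟩ :=
    hyp.exists_uniform_ergodicity hpar.r_pos hpar.a_pos hpar.b_pos L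
  have hex : ∀ rate, ∃ p : ℝ≥0 → ℝ≥0, rate ∈ PDMP.rateClass f m M r L a b →
      PDMP.IsUniqueInvariantDensity (PDMP.jumpKernel φ f rate) p ∧
      Integrable (PDMP.V f a b) (PDMP.densityMeasure p) ∧
      ∫ z, PDMP.V f a b z ∂(PDMP.densityMeasure p) ≤ D ∧
      PDMP.GeometricErgodicity (PDMP.jumpKernel φ f rate) (PDMP.densityMeasure p) (PDMP.V f a b)
        R₀ γ := fun rate => by
    by_cases h : rate ∈ PDMP.rateClass f m M r L a b
    · exact (herg rate h).imp fun p hp _ => hp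
    -- A default value outside the class, so that the density becomes a total function of the rate.
    · exact ⟨0, fun h' => absurd h' h⟩
  choose ν hν using hex
  have hV := PDMP.measurable_V (a := a) (b := b) f
  have hV1 := PDMP.one_le_V (a := a) (b := b) f hpar.a_pos hpar.b_pos
  have hV0 : ∀ x, 0 ≤ PDMP.V f a b x := fun x => zero_le_one.trans (hV1 x)
  have h1γ : 0 < 1 - γ := by linarith
  -- doubling the constant of the contraction makes room for the covariances
  refine ⟨2 * R₀, γ, ν, by positivity, hγ0, hγ1, fun rate hrate => ?_, fun z => ?_, fun x₀ => ?_⟩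
  · obtain ⟨hinv, hVi, -, hge⟩ := hν rate hrate
    refine ⟨hinv, ?_, fun k x => ⟨(hge k x).1, fun ψ hψ hψV => ?_⟩⟩
    · have h1 := (integrable_withDensity_iff_integrable_smul hinv.measurable).1 hVi
      refine h1.congr (ae_of_all _ fun z => ?_)
      simp only [NNReal.smul_def, smul_eq_mul, mul_comm]
    · rw [← PDMP.integral_densityMeasure hinv.measurable]
      refine ((hge k x).2 ψ hψ hψV).trans ?_
      have := hV0 x
      gcongr
      linarith
  · refine ⟨2 * R₀ / (1 - γ) * (PDMP.V f a b z + D), fun rate hrate => ?_⟩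
    obtain ⟨hinv, -, hVD, -⟩ := hν rate hrate
    rw [PDMP.G, ← PDMP.integral_densityMeasure hinv.measurable]
    gcongr
  · refine ⟨R₀ * PDMP.V f a b x₀ * (1 / (1 - γ)) +
      2 * (R₀ * PDMP.V f a b x₀ * (R₀ + 1)) * ∑' k : ℕ, (k : ℝ) * γ ^ k,
      fun rate hrate Ω _ P _ Z hZ s hs hbdd n hn => ?_⟩
    obtain ⟨hinv, hVi, hVD, hge⟩ := hν rate hrate
    have hmk := hyp.isMarkovKernel_jumpKernel hpar.a_pos hpar.b_pos hrate
    have hprob := hinv.isProbabilityMeasure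
    have hn0 : (0 : ℝ) < n := by exact_mod_cast hn
    have hsS : ∀ z, |s z| ≤ PDMP.supNorm s := fun z => le_ciSup hbdd z
    have hS : 0 ≤ PDMP.supNorm s := (abs_nonneg _).trans (hsS 0)
    have hchain := hZ.isMarkovChain
    set π := PDMP.densityMeasure (ν rate) with hπ
    constructor
    · rw [← PDMP.integral_densityMeasure hinv.measurable]
      refine (hchain.bias_le hge hV1 hR₀.le hγ0.le hγ1 hs hS hsS hn).trans ?_
      have := hV0 x₀
      gcongr
      linarith
    · refine (hchain.variance_mean_le hge hV hV1 hR₀.le hγ0.le hγ1 hs hS hsS hn).trans ?_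
      rw [← PDMP.integral_densityMeasure hinv.measurable]
      set I := ∫ x, PDMP.V f a b x * ν rate x ∂PDMP.halfLine with hI
      have hI0 : 0 ≤ I := integral_nonneg fun x => mul_nonneg (hV0 x) (NNReal.coe_nonneg _)
      have he : ∫ z, |s z| * ν rate z * PDMP.G f a b (2 * R₀) γ (ν rate) z ∂PDMP.halfLine =
          ∫ z, |s z| * (2 * R₀ / (1 - γ) * (PDMP.V f a b z + I)) ∂π := by
        rw [hπ, PDMP.integral_densityMeasure hinv.measurable]
        refine integral_congr_ae (ae_of_all _ fun z => ?_)
        simp only [PDMP.G]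
        ring
      -- The covariances contribute only the `V` part of `G`; the constant part I is nonnegative and
      -- is added for free.
      have hmono : 2 * R₀ / (1 - γ) * ∫ z, |s z| * PDMP.V f a b z ∂π ≤
          ∫ z, |s z| * ν rate z * PDMP.G f a b (2 * R₀) γ (ν rate) z ∂PDMP.halfLine := by
        rw [he, ← integral_const_mul]
        have hi : ∀ W : ℝ≥0 → ℝ, Measurable W → (∀ z, 0 ≤ W z) → Integrable W π →
            Integrable (fun z => |s z| * W z) π := fun W hW hW0 hWi =>
          PDMP.integrable_of_abs_le (hWi.const_mul (PDMP.supNorm s)) (by fun_prop) fun z => by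
            rw [abs_mul, abs_abs, abs_of_nonneg (hW0 z)]
            exact mul_le_mul_of_nonneg_right (hsS z) (hW0 z)
        refine integral_mono ((hi _ hV hV0 hVi).const_mul _)
          (hi _ (by fun_prop) (fun z => by have := hV0 z; positivity)
            ((hVi.add (integrable_const I)).const_mul _)) fun z => ?_
        have h1 : 0 ≤ |s z| * (2 * R₀ / (1 - γ) * I) := by positivity
        simp only
        linarith
      gcongr
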